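/- **Model.** For positive integers $N,M$ with $M\ge 2N$, a quantum algorithm with access to two functions $f,g:[N]\to[M]$ has a finite-dimensional state space with basis $|x,y,w\rangle$, where $x\in[N]\sqcup[N]$, $y\in\mathbb{Z}/M$ (identified with $[M]$) and $w$ ranges over an arbitrary finite workspace. It starts in a fixed unit vector, alternates $q$ oracle queries $|x,y,w\rangle\mapsto|x,y+F(x),w\rangle$ with arbitrary unitaries independent of $f,g$, where $F$ equals $f$ on the first copy of $[N]$ and $g$ on the second (so $q$ is the total number of queries to $f$ and $g$, which may be made in superposition), and finally measures in the computational basis and accepts iff the outcome lies in a fixed set. Let $\mathcal{D}_=$ (resp. $\mathcal{D}_\perp$) be the uniform distribution on pairs $(f,g)$ of injective functions $[N]\to[M]$ whose ranges are identical (resp. disjoint). **Theorem.** 1. There is a universal constant $C>0$ such that for all $N\ge1$ and $M\ge2N$, every quantum algorithm $A$ making $q$ queries in total to $f$ and $g$ satisfies $$\Bigl|\Pr_{(f,g)\leftarrow\mathcal{D}_=}[A^{f,g}\text{ accepts}]-\Pr_{(f,g)\leftarrow\mathcal{D}_\perp}[A^{f,g}\text{ accepts}]\Bigr|\le \frac{C\,q^3}{N}.$$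 2. Consequently the set-equality problem needs $\Theta(N^{1/3})$ quantum queries: for every fixed $\varepsilon\in(0,1/2)$ there are constants $c,C'>0$, depending only on $\varepsilon$, such that for all $N\ge1$ and $M\ge 2N$: (a) every quantum algorithm that accepts with probability at least $1-\varepsilon$ on $(f,g)\leftarrow\mathcal{D}_=$ and with probability at most $\varepsilon$ on $(f,g)\leftarrow\mathcal{D}_\perp$ makes at least $c\,N^{1/3}$ queries; (b) there is a quantum algorithm making at most $C'N^{1/3}$ queries that accepts with probability at least $1-\varepsilon$ on every pair of injective functions $f,g:[N]\to[M]$ with identical ranges, and with probability at most $\varepsilon$ on every such pair with disjoint ranges; in particular it also distinguishes $\mathcal{D}_=$ from $\mathcal{D}_\perp$ in the sense of (a). -/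

import Mathlib

noncomputable section

namespace QuantumQuery

/-- The action of an oracle for `F : X → Y` on computational basis states: the query register
`x`, the response register `y` and the workspace `w` go to `(x, y + F x, w)`. -/
def oraclePerm {X Y W : Type} [AddGroup Y] (F : X → Y) : Equiv.Perm (X × Y × W) where
  toFun i := (i.1, i.2.1 + F i.1, i.2.2)
  invFun i := (i.1, i.2.1 - F i.1, i.2.2)
  left_inv i := by simp
  right_inv i := by simp

/-- The quantum oracle `|x, y, w⟩ ↦ |x, y + F x, w⟩`, a unitary operator on the state space. -/
def oracle {X Y W : Type} [Fintype X] [Fintype Y] [AddGroup Y] [Fintype W] (F : X → Y) :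
    EuclideanSpace ℂ (X × Y × W) ≃ₗᵢ[ℂ] EuclideanSpace ℂ (X × Y × W) :=
  LinearIsometryEquiv.piLpCongrLeft 2 ℂ ℂ (oraclePerm F)

/-- A quantum query algorithm with a one-bit output that has access to a function `X → Y`.
It has a finite-dimensional workspace, starts in a fixed unit vector, makes `queries` many oracle
queries, applies the unitary `U k` right after query number `k` (counted from `0`; only
the `U k` with `k < queries` are ever applied), and finally measures in the computational basis,
outputting `1` ("accept") when the measured basis state lies in `accept`. -/
structure Algorithm (X Y : Type) [Fintype X] [Fintype Y] where
  /-- Labels of the basis states of the workspace. -/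
  W : Type
  [fintypeW : Fintype W]
  /-- Number of oracle queries. -/
  queries : ℕ
  /-- State before the first query. -/
  init : EuclideanSpace ℂ (X × Y × W)
  norm_init : ‖init‖ = 1
  /-- Input-independent unitary operations. -/
  U : ℕ → (EuclideanSpace ℂ (X × Y × W) ≃ₗᵢ[ℂ] EuclideanSpace ℂ (X × Y × W))
  /-- Accepting basis states. -/
  accept : Finset (X × Y × W)

attribute [instance] Algorithm.fintypeW

variable {X Y : Type} [Fintype X] [Fintype Y] [AddGroup Y]

/-- The state after `k` queries to `F` (and the unitaries that follow them). -/
def Algorithm.state (A : Algorithm X Y) (F : X → Y) : ℕ → EuclideanSpace ℂ (X × Y × A.W)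
  | 0 => A.init
  | k + 1 => A.U k (oracle F (A.state F k))

/-- The probability that `A` accepts when it is run with oracle `F` (Born rule). -/
def Algorithm.acceptProb (A : Algorithm X Y) (F : X → Y) : ℝ :=
  ∑ i ∈ A.accept, ‖A.state F A.queries i‖ ^ 2

end QuantumQuery

namespace SetEquality

open QuantumQuery

/-- An algorithm with quantum query access to two functions `f, g : [N] → [M]`. The two oracles
are accessed through one oracle for the combined function on `[N] ⊕ [N]`, so that `queries` is the
total number of queries to `f` and `g`, which may be made in superposition. -/
abbrev PairAlgorithm (N M : ℕ) : Type 1 := Algorithm (Fin N ⊕ Fin N) (Fin M)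

/-- Probability that `A` accepts when run with the oracles `p.1` and `p.2`. -/
def pairAcceptProb {N M : ℕ} [NeZero M] (A : PairAlgorithm N M)
    (p : (Fin N ↪ Fin M) × (Fin N ↪ Fin M)) : ℝ :=
  A.acceptProb (Sum.elim p.1 p.2)

open Classical in
/-- The pairs of injective functions `[N] → [M]` with identical ranges. -/
def equalPairs (N M : ℕ) : Finset ((Fin N ↪ Fin M) × (Fin N ↪ Fin M)) :=
  Finset.univ.filter fun p => Set.range p.1 = Set.range p.2

open Classical in
/-- The pairs of injective functions `[N] → [M]` with disjoint ranges. -/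
def disjointPairs (N M : ℕ) : Finset ((Fin N ↪ Fin M) × (Fin N ↪ Fin M)) :=
  Finset.univ.filter fun p => Disjoint (Set.range p.1) (Set.range p.2)

/-- Probability that `A` accepts when run on a uniformly random pair from `S`. -/
def avgAcceptProb {N M : ℕ} [NeZero M] (A : PairAlgorithm N M)
    (S : Finset ((Fin N ↪ Fin M) × (Fin N ↪ Fin M))) : ℝ :=
  (∑ p ∈ S, pairAcceptProb A p) / (S.card : ℝ)

/-- The advantage of `A` in distinguishing two random injective functions conditioned on having
identical ranges from two random injective functions conditioned on having disjoint ranges. -/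
def advantage {N M : ℕ} [NeZero M] (A : PairAlgorithm N M) : ℝ :=
  |avgAcceptProb A (equalPairs N M) - avgAcceptProb A (disjointPairs N M)|

/-- `A` distinguishes the two random cases with error at most `ε` (average case). -/
def Distinguishes {N M : ℕ} [NeZero M] (A : PairAlgorithm N M) (ε : ℝ) : Prop :=
  1 - ε ≤ avgAcceptProb A (equalPairs N M) ∧ avgAcceptProb A (disjointPairs N M) ≤ ε

/-- `A` solves the set equality problem with error at most `ε` on every pair of injective
functions that satisfies the promise (worst case). -/
def Solves {N M : ℕ} [NeZero M] (A : PairAlgorithm N M) (ε : ℝ) : Prop :=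
  (∀ p ∈ equalPairs N M, 1 - ε ≤ pairAcceptProb A p) ∧
    ∀ p ∈ disjointPairs N M, pairAcceptProb A p ≤ ε

end SetEquality

end

/-! The lower bound uses the polynomial method. After `q` queries every amplitude is a sum of
functions of the oracle `F`, each depending on at most `q` values of `F`; the acceptance probability
is therefore a sum of juntas on at most `d = 2 * q` values (`Algorithm.acceptProb_mem_juntaSum`).
Averaged over all relabellings of the codomain, a junta sees only which of its points collide. Under
a random map to `r` labels, a collision pattern with `c` classes on `s` points has probability
`r.descFactorial c / r ^ s`, a polynomial in `1 / r`. Hence one polynomial of degree at most `d`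
gives the average acceptance for random maps with `r` labels at `1 / r`, and for injective maps at
`0` (`exists_poly_of_mem_juntaSum`). It lies in `[0, 1]` at every `1 / r`, so by interpolation it
changes by only `O(d ^ 3 / N)` between `0` and `1 / N`.

A hybrid argument finishes (`advantage_le`). Equal ranges amount to two random permutations of `[N]`
followed by one random embedding. Turning each permutation into a random function costs `O(d ^ 3 /
N)`. The two functions form a single random function `[N] ⊕ [N] → [N]`, which at the same cost
becomes a random injection, that is, a pair with disjoint ranges.

For the upper bound, about `N ^ (1 / 3)` values of `f` are stored and Grover search looks for a
point where `g` takes a stored value. Equal ranges mark exactly `k` of the `N` points, so about `√(N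
/ k)` iterations suffice; disjoint ranges mark none, and acceptance has probability zero
(`exists_solves`). -/

noncomputable section

namespace QuantumQuery

open Finset

/-! ### Sums of juntas and their closure properties. -/

section Junta

variable {X Y E E' E'' : Type*} [AddCommMonoid E] [AddCommMonoid E'] [AddCommMonoid E'']

/-- Sums of functions of `F : X → Y` each of which depends on at most `k` values of `F`. -/
def juntaSum (X Y E : Type*) [AddCommMonoid E] (k : ℕ) : AddSubmonoid ((X → Y) → E) :=
  AddSubmonoid.closure {φ | ∃ S : Finset X, S.card ≤ k ∧ DependsOn φ (S : Set X)}

theorem mem_juntaSum_of_dependsOn {k : ℕ} {φ : (X → Y) → E} (S : Finset X) (hS : S.card ≤ k)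
    (h : DependsOn φ (S : Set X)) : φ ∈ juntaSum X Y E k :=
  AddSubmonoid.subset_closure ⟨S, hS, h⟩

theorem juntaSum_map (B : E →+ E') {k : ℕ} {φ : (X → Y) → E} (hφ : φ ∈ juntaSum X Y E k) :
    (fun F => B (φ F)) ∈ juntaSum X Y E' k := by
  induction hφ using AddSubmonoid.closure_induction with
  | mem φ h =>
    obtain ⟨S, hS, h⟩ := h
    exact mem_juntaSum_of_dependsOn S hS fun F G hFG => congrArg B (h hFG)
  | zero =>
    have : (fun F : X → Y => B ((0 : (X → Y) → E) F)) = 0 := by ext; simp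
    rw [this]; exact zero_mem _
  | add φ ψ _ _ h₁ h₂ =>
    have : (fun F : X → Y => B ((φ + ψ) F)) = (fun F => B (φ F)) + fun F => B (ψ F) := by
      ext; simp
    rw [this]; exact add_mem h₁ h₂

/-- The product of a junta on `S` and a junta on `T` is a junta on `S ∪ T`, so degrees add. -/
theorem juntaSum_bilin (B : E →+ E' →+ E'') {k l : ℕ} {φ : (X → Y) → E} {ψ : (X → Y) → E'}
    (hφ : φ ∈ juntaSum X Y E k) (hψ : ψ ∈ juntaSum X Y E' l) :
    (fun F => B (φ F) (ψ F)) ∈ juntaSum X Y E'' (k + l) := by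
  classical
  induction hφ using AddSubmonoid.closure_induction with
  | mem φ h₁ =>
    obtain ⟨S, hS, h⟩ := h₁
    induction hψ using AddSubmonoid.closure_induction with
    | mem ψ h₂ =>
      obtain ⟨T, hT, h'⟩ := h₂
      refine mem_juntaSum_of_dependsOn (S ∪ T) ((card_union_le _ _).trans (by lia)) ?_
      intro F G hFG
      have e₁ : φ F = φ G := h fun i hi => hFG i (by simp at hi ⊢; exact Or.inl hi)
      have e₂ : ψ F = ψ G := h' fun i hi => hFG i (by simp at hi ⊢; exact Or.inr hi)
      simp only [e₁, e₂]
    | zero =>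
      have : (fun F : X → Y => B (φ F) ((0 : (X → Y) → E') F)) = 0 := by ext; simp
      rw [this]; exact zero_mem _
    | add ψ ψ' _ _ h₁ h₂ =>
      have : (fun F : X → Y => B (φ F) ((ψ + ψ') F)) =
        (fun F => B (φ F) (ψ F)) + fun F => B (φ F) (ψ' F) := by ext; simp
      rw [this]; exact add_mem h₁ h₂
  | zero =>
    have : (fun F : X → Y => B ((0 : (X → Y) → E) F) (ψ F)) = 0 := by ext; simp
    rw [this]; exact zero_mem _
  | add φ φ' _ _ h₁ h₂ =>
    have : (fun F : X → Y => B ((φ + φ') F) (ψ F)) =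
      (fun F => B (φ F) (ψ F)) + fun F => B (φ' F) (ψ F) := by ext; simp
    rw [this]; exact add_mem h₁ h₂

/-- Substituting for `F : X → Y` a function each of whose values depends on at most one value of
`G : X' → Y'` preserves sums of juntas. -/
theorem juntaSum_comp {X' Y' : Type*} {k : ℕ} {φ : (X → Y) → E} (hφ : φ ∈ juntaSum X Y E k)
    (s : (X' → Y') → X → Y) (d : X → Set X') (hd : ∀ x, (d x).Subsingleton)
    (hs : ∀ x, DependsOn (fun G => s G x) (d x)) :
    (fun G => φ (s G)) ∈ juntaSum X' Y' E k := by
  classical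
  induction hφ using AddSubmonoid.closure_induction with
  | mem φ h =>
    obtain ⟨S, hS, h⟩ := h
    refine mem_juntaSum_of_dependsOn (S.biUnion fun x => (hd x).finite.toFinset) ?_ ?_
    · refine (card_biUnion_le).trans (le_trans (sum_le_card_nsmul _ _ 1 ?_) (by simpa using hS))
      intro x _
      rw [Finset.card_le_one]
      intro a ha b hb
      exact hd x (by simpa using ha) (by simpa using hb)
    · intro F G hFG
      refine h fun x hx => hs x fun i hi => hFG i ?_
      simp only [coe_biUnion, Set.mem_iUnion]
      exact ⟨x, hx, by simpa using hi⟩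
  | zero => exact zero_mem (juntaSum X' Y' E k)
  | add φ ψ _ _ h₁ h₂ => exact add_mem h₁ h₂

end Junta

/-! ### Acceptance probabilities as sums of juntas. -/

section AcceptProb

variable {X Y : Type} [Fintype X] [Fintype Y] [AddGroup Y]

theorem oracle_apply {W : Type} [Fintype W] (F : X → Y) (v : EuclideanSpace ℂ (X × Y × W))
    (i : X × Y × W) : oracle F v i = v (i.1, i.2.1 - F i.1, i.2.2) := by
  simp [oracle, LinearIsometryEquiv.piLpCongrLeft_apply, oraclePerm, Equiv.piCongrLeft'_apply]

/-- The oracle preserves the query register. Followed by the projection `P x` to query `x`, it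
involves only `F x`, and these projections sum to the identity. -/
theorem oracle_mem_juntaSum (W : Type) [Fintype W] :
    (fun F : X → Y => ((oracle F : EuclideanSpace ℂ (X × Y × W) ≃ₗᵢ[ℂ] _).toLinearEquiv.toLinearMap.toAddMonoidHom))
      ∈ juntaSum X Y (EuclideanSpace ℂ (X × Y × W) →+ EuclideanSpace ℂ (X × Y × W)) 1 := by
  classical
  let P : X → EuclideanSpace ℂ (X × Y × W) →+ EuclideanSpace ℂ (X × Y × W) := fun x =>
    { toFun := fun v => WithLp.toLp 2 fun i => if i.1 = x then v i else 0
      map_zero' := by ext; simp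
      map_add' := fun v w => by ext i; by_cases h : i.1 = x <;> simp [h] }
  have key : (fun F : X → Y => ((oracle F : EuclideanSpace ℂ (X × Y × W) ≃ₗᵢ[ℂ] _).toLinearEquiv.toLinearMap.toAddMonoidHom))
      = ∑ x, fun F : X → Y => (P x).comp
        ((oracle F : EuclideanSpace ℂ (X × Y × W) ≃ₗᵢ[ℂ] _).toLinearEquiv.toLinearMap.toAddMonoidHom) := by
    ext F v i
    simp [P]
  rw [key]
  refine sum_mem fun x _ => mem_juntaSum_of_dependsOn {x} (by simp) ?_
  intro F G hFG
  have hx : F x = G x := hFG x (by simp)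
  ext v i
  by_cases h : i.1 = x
  · subst h
    simp [P, oracle_apply, hx]
  · simp [P, h]

theorem Algorithm.state_mem_juntaSum (A : Algorithm X Y) (k : ℕ) :
    (fun F => A.state F k) ∈ juntaSum X Y (EuclideanSpace ℂ (X × Y × A.W)) k := by
  induction k with
  | zero => exact mem_juntaSum_of_dependsOn ∅ (by simp) fun _ _ _ => rfl
  | succ k ih =>
    have h := juntaSum_bilin (AddMonoidHom.id _) (oracle_mem_juntaSum A.W) ih
    rw [add_comm] at h
    exact juntaSum_map (A.U k).toLinearEquiv.toLinearMap.toAddMonoidHom h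

theorem Algorithm.acceptProb_mem_juntaSum (A : Algorithm X Y) :
    A.acceptProb ∈ juntaSum X Y ℝ (2 * A.queries) := by
  have key : A.acceptProb = ∑ i ∈ A.accept, fun F =>
      (Complex.reAddGroupHom : ℂ →+ ℝ)
        (A.state F A.queries i * (starRingEnd ℂ) (A.state F A.queries i)) := by
    ext F
    simp [Algorithm.acceptProb, Complex.mul_conj, Complex.normSq_eq_norm_sq]
    norm_cast
  rw [key]
  refine sum_mem fun i _ => juntaSum_map _ ?_
  have h₁ : (fun F => A.state F A.queries i) ∈ juntaSum X Y ℂ A.queries :=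
    juntaSum_map (EuclideanSpace.proj (𝕜 := ℂ) i).toLinearMap.toAddMonoidHom
      (A.state_mem_juntaSum A.queries)
  have h₂ := juntaSum_map (starRingEnd ℂ).toAddMonoidHom h₁
  -- The squared modulus is an amplitude times its conjugate, hence the doubled degree.
  rw [two_mul]
  exact juntaSum_bilin AddMonoidHom.mul h₁ h₂

theorem Algorithm.norm_state (A : Algorithm X Y) (F : X → Y) (k : ℕ) : ‖A.state F k‖ = 1 := by
  induction k with
  | zero => exact A.norm_init
  | succ k ih => simp [Algorithm.state, ih]

theorem Algorithm.acceptProb_nonneg (A : Algorithm X Y) (F : X → Y) : 0 ≤ A.acceptProb F :=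
  sum_nonneg fun _ _ => by positivity

theorem Algorithm.acceptProb_le_one (A : Algorithm X Y) (F : X → Y) : A.acceptProb F ≤ 1 := by
  have h := EuclideanSpace.norm_sq_eq (A.state F A.queries)
  rw [A.norm_state, one_pow] at h
  rw [h]
  exact sum_le_sum_of_subset_of_nonneg (subset_univ _) fun _ _ _ => by positivity

end AcceptProb

end QuantumQuery

end

/-! ### Polynomials bounded at the reciprocals of the positive integers. -/

noncomputable section

namespace Polynomial

open Finset

theorem prod_Ico_sq_div (j : ℕ) :
    ∏ i ∈ Ico 1 (j + 1), ((i : ℝ) ^ 2 / |((j + 1 : ℕ) : ℝ) ^ 2 - (i : ℝ) ^ 2|) =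
      2 * (((j + 1).factorial : ℝ) ^ 2 / (2 * (j + 1)).factorial) := by
  have h₁ : ∀ i ∈ range j, ((1 + i : ℕ) : ℝ) ^ 2 / |((j + 1 : ℕ) : ℝ) ^ 2 - ((1 + i : ℕ) : ℝ) ^ 2| =
      ((i + 1 : ℕ) : ℝ) ^ 2 / (((j - 1 - i + 1 : ℕ) : ℝ) * ((j + 2 + i : ℕ) : ℝ)) := by
    intro i hi
    rw [mem_range] at hi
    have : ((j - 1 - i + 1 : ℕ) : ℝ) = j - i := by
      rw [show j - 1 - i + 1 = j - i by lia, Nat.cast_sub hi.le]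
    have hi' : (i : ℝ) ≤ j := by exact_mod_cast hi.le
    rw [this, abs_of_nonneg]
    · push_cast; congr 1 <;> ring
    · push_cast; nlinarith [Nat.cast_nonneg (α := ℝ) i]
  rw [prod_Ico_eq_prod_range, Nat.add_sub_cancel, prod_congr rfl h₁, prod_div_distrib,
    prod_mul_distrib, prod_range_reflect (fun i => ((i + 1 : ℕ) : ℝ)) j, prod_pow]
  have h₂ : ∏ i ∈ range j, ((i + 1 : ℕ) : ℝ) = j.factorial := by
    rw [← prod_range_add_one_eq_factorial]; push_cast; rfl
  have h₃ : ∏ i ∈ range j, ((j + 2 + i : ℕ) : ℝ) = ((j + 2).ascFactorial j : ℕ) := by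
    rw [Nat.ascFactorial_eq_prod_range]; push_cast; rfl
  have h₄ : (((j + 1).factorial : ℕ) : ℝ) * ((j + 2).ascFactorial j : ℕ) =
      (2 * j + 1).factorial := by
    rw [← Nat.cast_mul, Nat.factorial_mul_ascFactorial]; congr 2; ring
  have h₅ : (((2 * (j + 1)).factorial : ℕ) : ℝ) = (2 * (j + 1)) * (2 * j + 1).factorial := by
    rw [show 2 * (j + 1) = 2 * j + 1 + 1 by ring, Nat.factorial_succ]; push_cast; ring
  have p₁ : (j.factorial : ℝ) ≠ 0 := by positivity
  have p₂ : ((j + 2).ascFactorial j : ℝ) ≠ 0 := by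
    have := Nat.ascFactorial_pos (j + 1) j
    positivity
  rw [h₂, h₃, h₅, ← h₄, Nat.factorial_succ]
  push_cast
  field_simp

/-- For unrounded nodes `r j = R / j ^ 2`, the product of the `r j / |r j - r i|` is this one,
whatever `R` is. The Gaussian decay of its value in `j` later pays for rounding the nodes to
integers. -/
theorem prod_sq_div_abs_sq_sub_sq (d j : ℕ) (hj : 1 ≤ j) (hd : j ≤ d) :
    ∏ i ∈ (Icc 1 d).erase j, ((i : ℝ) ^ 2 / |(j : ℝ) ^ 2 - (i : ℝ) ^ 2|) =
      2 * ((d.factorial : ℝ) ^ 2 / ((d - j).factorial * (d + j).factorial)) := by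
  induction d, hd using Nat.le_induction with
  | base =>
    obtain ⟨j, rfl⟩ : ∃ k, j = k + 1 := ⟨j - 1, by lia⟩
    have : (Icc 1 (j + 1)).erase (j + 1) = Ico 1 (j + 1) := by
      ext i; simp only [mem_erase, mem_Icc, mem_Ico]; lia
    rw [this, prod_Ico_sq_div]
    simp [two_mul]
  | succ d hd ih =>
    have h₁ : (Icc 1 (d + 1)).erase j = insert (d + 1) ((Icc 1 d).erase j) := by
      ext i; simp only [mem_erase, mem_Icc, mem_insert]; lia
    have hj' : (j : ℝ) ≤ d := by exact_mod_cast hd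
    rw [h₁, prod_insert (by simp), ih, abs_sub_comm, abs_of_nonneg,
      show d + 1 - j = d - j + 1 by lia, show d + 1 + j = d + j + 1 by lia,
      Nat.factorial_succ d, Nat.factorial_succ (d - j), Nat.factorial_succ (d + j)]
    · push_cast [Nat.cast_sub hd]
      rw [show ((d : ℝ) + 1) ^ 2 - (j : ℝ) ^ 2 = (d - j + 1) * (d + j + 1) by ring]
      have : (d : ℝ) - j + 1 ≠ 0 := by linarith
      field_simp
    · push_cast; nlinarith [Nat.cast_nonneg (α := ℝ) j]

/-- Passing from `j` to `j + 1` multiplies the left side by `1 - (2 * j + 1) / (d + j + 1)`, at most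
`exp (-(2 * j + 1) / (2 * d))`; the odd numbers add up to a square. -/
theorem sq_factorial_div_le (d j : ℕ) (hd : j ≤ d) :
    (d.factorial : ℝ) ^ 2 / ((d - j).factorial * (d + j).factorial) ≤
      Real.exp (-(j : ℝ) ^ 2 / (2 * d)) := by
  induction j with
  | zero => simp [sq]; rw [div_self]; positivity
  | succ j ih =>
    have hd₀ : (0 : ℝ) < d := by exact_mod_cast (by lia : 0 < d)
    have hj : (j : ℝ) + 1 ≤ d := by exact_mod_cast hd
    have h₁ : ((d - j).factorial : ℝ) = (d - j) * (d - (j + 1)).factorial := by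
      rw [show d - j = d - (j + 1) + 1 by lia, Nat.factorial_succ]
      push_cast [Nat.cast_sub hd]; ring
    have h₂ : (((d + (j + 1)).factorial : ℕ) : ℝ) = (d + j + 1) * (d + j).factorial := by
      rw [← add_assoc, Nat.factorial_succ]; push_cast; ring
    have h₃ : (d.factorial : ℝ) ^ 2 / ((d - (j + 1)).factorial * (d + (j + 1)).factorial) =
        (d.factorial : ℝ) ^ 2 / ((d - j).factorial * (d + j).factorial) *
          ((d - j) / (d + j + 1)) := by
      rw [h₁, h₂]
      have : (d : ℝ) - j ≠ 0 := by linarith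
      field_simp
    have h₄ : ((d : ℝ) - j) / (d + j + 1) ≤ Real.exp (-(2 * j + 1) / (2 * d)) := by
      have h := Real.add_one_le_exp (-(2 * j + 1) / (2 * d) : ℝ)
      refine le_trans ?_ h
      rw [div_add_one (by positivity), div_le_div_iff₀ (by positivity) (by positivity)]
      nlinarith [Nat.cast_nonneg (α := ℝ) j]
    rw [h₃]
    refine (mul_le_mul (ih (by lia)) h₄ (div_nonneg (by linarith) (by positivity))
      (Real.exp_nonneg _)).trans (le_of_eq ?_)
    rw [← Real.exp_add]
    congr 1
    push_cast
    field_simp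
    ring

theorem floor_node_ratio_le (d i j : ℕ) (hi : 1 ≤ i) (hid : i ≤ d) (hj : 1 ≤ j) (hjd : j ≤ d)
    (hij : i ≠ j) :
    ((4 * d ^ 3 / i ^ 2 : ℕ) : ℝ) ≠ ((4 * d ^ 3 / j ^ 2 : ℕ) : ℝ) ∧
    ((4 * d ^ 3 / j ^ 2 : ℕ) : ℝ) / |((4 * d ^ 3 / j ^ 2 : ℕ) : ℝ) - ((4 * d ^ 3 / i ^ 2 : ℕ) : ℝ)|
      ≤ (i : ℝ) ^ 2 / |(j : ℝ) ^ 2 - (i : ℝ) ^ 2| * Real.exp ((j : ℝ) ^ 2 / (2 * (d : ℝ) ^ 2)) := by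
  have hi₁ : (1 : ℝ) ≤ i := by exact_mod_cast hi
  have hj₁ : (1 : ℝ) ≤ j := by exact_mod_cast hj
  have hid' : (i : ℝ) ≤ d := by exact_mod_cast hid
  have hjd' : (j : ℝ) ≤ d := by exact_mod_cast hjd
  have bound : ∀ k : ℕ, 1 ≤ k → ((4 * d ^ 3 / k ^ 2 : ℕ) : ℝ) ≤ 4 * (d : ℝ) ^ 3 / (k : ℝ) ^ 2 ∧
      4 * (d : ℝ) ^ 3 / (k : ℝ) ^ 2 - 1 ≤ ((4 * d ^ 3 / k ^ 2 : ℕ) : ℝ) := by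
    intro k hk
    constructor
    · exact_mod_cast Nat.cast_div_le (α := ℝ) (m := 4 * d ^ 3) (n := k ^ 2)
    · have := Nat.lt_div_mul_add (a := 4 * d ^ 3) (b := k ^ 2) (by positivity)
      have h : (4 * (d : ℝ) ^ 3) < ((4 * d ^ 3 / k ^ 2 : ℕ) : ℝ) * k ^ 2 + k ^ 2 := by
        exact_mod_cast this
      rw [tsub_le_iff_right, div_le_iff₀ (by positivity)]
      linarith
  obtain ⟨a₁, a₂⟩ := bound i hi
  obtain ⟨b₁, b₂⟩ := bound j hj
  generalize ((4 * d ^ 3 / i ^ 2 : ℕ) : ℝ) = a at *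
  generalize hb : ((4 * d ^ 3 / j ^ 2 : ℕ) : ℝ) = b at *
  have hb₀ : 0 ≤ b := hb ▸ Nat.cast_nonneg _
  set D : ℝ := |(j : ℝ) ^ 2 - (i : ℝ) ^ 2| with hD
  have hDij : (i : ℝ) + j ≤ D := by
    rw [hD, show (j : ℝ) ^ 2 - (i : ℝ) ^ 2 = (j - i) * (j + i) by ring, abs_mul,
      abs_of_nonneg (by positivity : (0 : ℝ) ≤ j + i)]
    have : (1 : ℝ) ≤ |(j : ℝ) - i| := by
      have : (1 : ℤ) ≤ |(j : ℤ) - i| := Int.one_le_abs (by lia)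
      exact_mod_cast this
    nlinarith
  have hd₀ : (0 : ℝ) < d := by linarith
  have hD₀ : 0 < D := by linarith
  set R : ℝ := 4 * (d : ℝ) ^ 3 with hR
  have hR₀ : 0 < R := by positivity
  have hdist : R * D / ((i : ℝ) ^ 2 * (j : ℝ) ^ 2) - 1 ≤ |b - a| := by
    have e : R * D / ((i : ℝ) ^ 2 * (j : ℝ) ^ 2) = |R / (j : ℝ) ^ 2 - R / (i : ℝ) ^ 2| := by
      rw [div_sub_div _ _ (by positivity) (by positivity), abs_div,
        abs_of_pos (by positivity : (0 : ℝ) < (j : ℝ) ^ 2 * (i : ℝ) ^ 2),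
        show R * (i : ℝ) ^ 2 - (j : ℝ) ^ 2 * R = R * -((j : ℝ) ^ 2 - (i : ℝ) ^ 2) by ring,
        abs_mul, abs_of_pos hR₀, abs_neg, mul_comm ((j : ℝ) ^ 2)]
    rw [e]
    have h1 := abs_sub_abs_le_abs_sub (R / (j : ℝ) ^ 2 - R / (i : ℝ) ^ 2) (b - a)
    have h2 : |R / (j : ℝ) ^ 2 - R / (i : ℝ) ^ 2 - (b - a)| ≤ 1 := by
      rw [abs_le]; constructor <;> linarith
    linarith
  -- Rounding changes the gap between two nodes by at most `1`. The scale `4 * d ^ 3` makes this at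
  -- most a fraction `δ` of the exact gap: `δ` times that gap is `d * D / i ^ 2 ≥ 1`. As `δ ≤ 1 /
  -- 4`, the resulting factor `(1 - δ)⁻¹` is at most `exp (2 * δ)`.
  set δ : ℝ := (j : ℝ) ^ 2 / (4 * (d : ℝ) ^ 2) with hδ
  have hδ₀ : 0 ≤ δ := by positivity
  have hδ₁ : δ ≤ 1 / 4 := by
    rw [hδ, div_le_iff₀ (by positivity)]; nlinarith
  have hmain : R * D / ((i : ℝ) ^ 2 * (j : ℝ) ^ 2) * (1 - δ) ≤ |b - a| := by
    refine le_trans ?_ hdist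
    have : 1 ≤ R * D / ((i : ℝ) ^ 2 * (j : ℝ) ^ 2) * δ := by
      have e : R * D / ((i : ℝ) ^ 2 * (j : ℝ) ^ 2) * δ = d * D / (i : ℝ) ^ 2 := by
        rw [hδ, hR]; field_simp
      rw [e, le_div_iff₀ (by positivity)]
      nlinarith
    linarith
  have hpos : 0 < R * D / ((i : ℝ) ^ 2 * (j : ℝ) ^ 2) * (1 - δ) :=
    mul_pos (by positivity) (by linarith)
  constructor
  · rintro rfl
    simp at hmain
    linarith
  · calc b / |b - a| ≤ (R / (j : ℝ) ^ 2) / (R * D / ((i : ℝ) ^ 2 * (j : ℝ) ^ 2) * (1 - δ)) :=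
        div_le_div₀ (by positivity) b₁ hpos hmain
      _ = (i : ℝ) ^ 2 / D * (1 - δ)⁻¹ := by
        have : (1 - δ) ≠ 0 := by linarith
        field_simp
      _ ≤ _ := by
        gcongr
        rw [inv_le_iff_one_le_mul₀ (by linarith)]
        have h := Real.add_one_le_exp ((j : ℝ) ^ 2 / (2 * (d : ℝ) ^ 2))
        have e : (j : ℝ) ^ 2 / (2 * (d : ℝ) ^ 2) = 2 * δ := by rw [hδ]; field_simp; norm_num
        rw [e] at h ⊢
        nlinarith

/-- Fewer than `d` rounding factors `exp (j ^ 2 / (2 * d ^ 2))` occur, and the decay `exp (-j ^ 2 /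
(2 * d))` of the exact product cancels them. -/
theorem prod_floor_node_ratio_le (d j : ℕ) (hj : 1 ≤ j) (hjd : j ≤ d) :
    ∏ i ∈ (Icc 1 d).erase j, (((4 * d ^ 3 / j ^ 2 : ℕ) : ℝ) /
      |((4 * d ^ 3 / j ^ 2 : ℕ) : ℝ) - ((4 * d ^ 3 / i ^ 2 : ℕ) : ℝ)|) ≤ 2 := by
  have hd₀ : (0 : ℝ) < d := by exact_mod_cast (by lia : 0 < d)
  have hmem : j ∈ Icc 1 d := by simp [hj, hjd]
  calc _ ≤ ∏ i ∈ (Icc 1 d).erase j, ((i : ℝ) ^ 2 / |(j : ℝ) ^ 2 - (i : ℝ) ^ 2| *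
        Real.exp ((j : ℝ) ^ 2 / (2 * (d : ℝ) ^ 2))) := by
        refine prod_le_prod (fun i _ => by positivity) fun i hi => ?_
        simp only [mem_erase, mem_Icc] at hi
        exact (floor_node_ratio_le d i j hi.2.1 hi.2.2 hj hjd hi.1).2
    _ ≤ 2 * Real.exp (-(j : ℝ) ^ 2 / (2 * d)) * Real.exp ((j : ℝ) ^ 2 / (2 * d)) := by
        rw [prod_mul_distrib, prod_sq_div_abs_sq_sub_sq d j hj hjd, prod_const,
          card_erase_of_mem hmem, Nat.card_Icc, ← Real.exp_nat_mul]
        have := sq_factorial_div_le d j hjd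
        gcongr
        have hc : ((d + 1 - 1 - 1 : ℕ) : ℝ) ≤ d := Nat.cast_le.mpr (by lia)
        calc _ ≤ (d : ℝ) * ((j : ℝ) ^ 2 / (2 * (d : ℝ) ^ 2)) := by gcongr
          _ = _ := by field_simp
    _ = 2 := by rw [mul_assoc, ← Real.exp_add, neg_div]; simp

theorem sum_one_div_sq_le (d : ℕ) : ∑ j ∈ Icc 1 d, 1 / (j : ℝ) ^ 2 ≤ 2 - 1 / (d : ℝ) := by
  induction d with
  | zero => simp
  | succ d ih =>
    rw [sum_Icc_succ_top (by lia)]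
    rcases Nat.eq_zero_or_pos d with rfl | hd
    · norm_num
    · have hd' : (0 : ℝ) < d := by exact_mod_cast hd
      have : (1 : ℝ) / ((d + 1 : ℕ) : ℝ) ^ 2 ≤ 1 / d - 1 / ((d + 1 : ℕ) : ℝ) := by
        push_cast
        rw [div_sub_div _ _ (by positivity) (by positivity),
          div_le_div_iff₀ (by positivity) (by positivity)]
        nlinarith
      linarith

/-- A polynomial of degree at most `d` that takes values in `[0, 1]` at all points `1 / r` varies
by `O(d ^ 3 / N)` between `0` and `1 / N`. -/
theorem abs_eval_one_div_sub_eval_zero_le {p : ℝ[X]} {d : ℕ} (hp : p.natDegree ≤ d)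
    (h : ∀ r : ℕ, 1 ≤ r → p.eval (1 / (r : ℝ)) ∈ Set.Icc (0 : ℝ) 1) (N : ℕ) (hN : 1 ≤ N) :
    |p.eval (1 / (N : ℝ)) - p.eval 0| ≤ 16 * (d : ℝ) ^ 3 / N := by
  have hN₀ : (0 : ℝ) < N := by exact_mod_cast hN
  have h0 : p.eval 0 ∈ Set.Icc (0 : ℝ) 1 := by
    refine isClosed_Icc.mem_of_tendsto ((p.continuous.tendsto 0).comp
      (tendsto_one_div_atTop_nhds_zero_nat (𝕜 := ℝ))) ?_
    filter_upwards [Filter.eventually_ge_atTop 1] with r hr using h r hr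
  have hle : ∀ r : ℕ, 1 ≤ r → |p.eval (1 / (r : ℝ)) - p.eval 0| ≤ 1 := by
    intro r hr
    obtain ⟨a, b⟩ := h r hr
    obtain ⟨a', b'⟩ := h0
    rw [abs_le]; constructor <;> linarith
  rcases Nat.eq_zero_or_pos d with rfl | hd
  · rw [eq_C_of_natDegree_le_zero hp]; simp
  have hd₀ : (1 : ℝ) ≤ d := by exact_mod_cast hd
  -- For small `N` the claimed bound exceeds `1`. Otherwise all the interpolation nodes chosen below
  -- satisfy `r j ≤ N`.
  rcases le_or_gt N (4 * d ^ 3) with hNd | hNd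
  · refine (hle N hN).trans ?_
    rw [le_div_iff₀ hN₀]
    have : (N : ℝ) ≤ 4 * (d : ℝ) ^ 3 := by exact_mod_cast hNd
    have : (0 : ℝ) ≤ (d : ℝ) ^ 3 := by positivity
    linarith
  -- `(p - p(0)) / X`, of degree below `d`, is interpolated at the `d` points `1 / r j`. Its value
  -- there is at most `r j`, and the spacing like `1 / j ^ 2` makes these bounds sum to `O(d ^ 3)`.
  let r : ℕ → ℝ := fun j => ((4 * d ^ 3 / j ^ 2 : ℕ) : ℝ)
  have hr : ∀ j ∈ Icc 1 d, 1 ≤ 4 * d ^ 3 / j ^ 2 := by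
    intro j hj
    rw [mem_Icc] at hj
    rw [Nat.one_le_div_iff (by have := hj.1; positivity)]
    calc j ^ 2 ≤ d ^ 2 := Nat.pow_le_pow_left hj.2 2
      _ ≤ d ^ 3 := Nat.pow_le_pow_right hd (by norm_num)
      _ ≤ 4 * d ^ 3 := by lia
  have hr₀ : ∀ j ∈ Icc 1 d, 0 < r j := fun j hj => by
    have := hr j hj
    exact Nat.cast_pos.mpr (by lia)
  have hrN : ∀ j, r j ≤ N := fun j => by
    have : 4 * d ^ 3 / j ^ 2 ≤ 4 * d ^ 3 := Nat.div_le_self _ _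
    exact Nat.cast_le.mpr (by lia)
  have hinj : Set.InjOn (fun j => 1 / r j) (Icc 1 d : Finset ℕ) := by
    intro i hi j hj hij
    by_contra hne
    rw [mem_coe, mem_Icc] at hi hj
    have hij' : 1 / r i = 1 / r j := hij
    exact (floor_node_ratio_le d i j hi.1 hi.2 hj.1 hj.2 hne).1
      (by simpa [r] using congrArg (fun x : ℝ => x⁻¹) hij')
  have hs : ∀ x, x ≠ 0 → p.divX.eval x = (p.eval x - p.eval 0) / x := by
    intro x hx
    have := congrArg (eval x) (divX_mul_X_add p)
    rw [eval_add, eval_mul, eval_X, eval_C, coeff_zero_eq_eval_zero] at this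
    rw [eq_div_iff hx]; linarith
  have hdeg : p.divX.degree < (Icc 1 d).card := by
    refine degree_le_natDegree.trans_lt ?_
    rw [natDegree_divX_eq_natDegree_tsub_one, Nat.card_Icc]
    exact_mod_cast (by lia)
  have hL : p.divX.eval (1 / (N : ℝ)) = ∑ j ∈ Icc 1 d,
      p.divX.eval (1 / r j) * (Lagrange.basis (Icc 1 d) (fun j => 1 / r j) j).eval (1 / (N : ℝ)) := by
    conv_lhs => rw [Lagrange.eq_interpolate hinj hdeg, Lagrange.interpolate_apply]
    simp [eval_finsetSum]
  have hbasis : ∀ j ∈ Icc 1 d,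
      |(Lagrange.basis (Icc 1 d) (fun j => 1 / r j) j).eval (1 / (N : ℝ))| ≤ 2 := by
    intro j hj
    have hj' := mem_Icc.mp hj
    refine le_trans ?_ (prod_floor_node_ratio_le d j hj'.1 hj'.2)
    rw [Lagrange.basis, eval_prod, abs_prod]
    refine prod_le_prod (fun _ _ => abs_nonneg _) fun i hi => ?_
    have hi' := mem_of_mem_erase hi
    have ri := hr₀ i hi'
    have rj := hr₀ j hj
    rw [Lagrange.basisDivisor, eval_mul, eval_C, eval_sub, eval_X, eval_C, abs_mul, abs_inv]
    change |1 / r j - 1 / r i|⁻¹ * |1 / (N : ℝ) - 1 / r i| ≤ r j / |r j - r i|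
    have e₁ : |1 / r j - 1 / r i| = |r j - r i| / (r j * r i) := by
      rw [div_sub_div _ _ rj.ne' ri.ne', abs_div, abs_of_pos (mul_pos rj ri), one_mul, mul_one,
        abs_sub_comm]
    -- Evaluating at `1 / N ≤ 1 / r i` is no worse than at `0`, where the basis polynomial gives
    -- exactly the product already bounded.
    have e₂ : |1 / (N : ℝ) - 1 / r i| ≤ 1 / r i := by
      have : 1 / (N : ℝ) ≤ 1 / r i := one_div_le_one_div_of_le ri (hrN i)
      have : 0 < 1 / (N : ℝ) := by positivity
      rw [abs_le]; constructor <;> linarith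
    rw [e₁, inv_div]
    calc _ ≤ r j * r i / |r j - r i| * (1 / r i) := by gcongr
      _ = _ := by field_simp
  have hval : ∀ j ∈ Icc 1 d, |p.divX.eval (1 / r j)| ≤ 4 * (d : ℝ) ^ 3 * (1 / (j : ℝ) ^ 2) := by
    intro j hj
    have rj := hr₀ j hj
    rw [hs _ (by positivity), abs_div, abs_of_pos (by positivity : 0 < 1 / r j), div_div_eq_mul_div,
      div_one]
    have h₁ : r j ≤ 4 * (d : ℝ) ^ 3 * (1 / (j : ℝ) ^ 2) := by
      rw [mul_one_div]
      exact_mod_cast Nat.cast_div_le (α := ℝ) (m := 4 * d ^ 3) (n := j ^ 2)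
    calc _ ≤ 1 * r j := by
          gcongr
          exact hle _ (hr j hj)
      _ ≤ _ := by rw [one_mul]; exact h₁
  have hfin : |p.divX.eval (1 / (N : ℝ))| ≤ 16 * (d : ℝ) ^ 3 := by
    rw [hL]
    calc _ ≤ ∑ j ∈ Icc 1 d, 4 * (d : ℝ) ^ 3 * (1 / (j : ℝ) ^ 2) * 2 := by
          refine (abs_sum_le_sum_abs _ _).trans (sum_le_sum fun j hj => ?_)
          rw [abs_mul]
          exact mul_le_mul (hval j hj) (hbasis j hj) (abs_nonneg _) (by positivity)
      _ = 4 * (d : ℝ) ^ 3 * (∑ j ∈ Icc 1 d, 1 / (j : ℝ) ^ 2) * 2 := by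
          rw [mul_sum, sum_mul]
      _ ≤ 4 * (d : ℝ) ^ 3 * 2 * 2 := by
          have := sum_one_div_sq_le d
          have : 0 ≤ 1 / (d : ℝ) := by positivity
          gcongr
          linarith
      _ = _ := by ring
  rw [hs _ (by positivity), abs_div, abs_of_pos (by positivity : 0 < 1 / (N : ℝ)),
    div_div_eq_mul_div, div_one] at hfin
  rwa [le_div_iff₀ hN₀]

end Polynomial

end

/-! ### Symmetrization over relabellings: from juntas to a polynomial in `1 / r`. -/

noncomputable section

namespace QuantumQuery

open Finset Polynomial

theorem exists_perm_comp_eqOn {X Y : Type*} [Fintype Y] {S : Set X} {τ τ' : X → Y}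
    (h : ∀ x ∈ S, ∀ x' ∈ S, τ x = τ x' ↔ τ' x = τ' x') :
    ∃ g : Equiv.Perm Y, ∀ x ∈ S, g (τ x) = τ' x := by
  classical
  have hex : ∀ y : Y, ∃ z : Y, ∀ x ∈ S, τ x = y → τ' x = z := by
    intro y
    by_cases hy : ∃ x ∈ S, τ x = y
    · obtain ⟨x, hx, rfl⟩ := hy
      exact ⟨τ' x, fun x' hx' e => (h x' hx' x hx).1 e⟩
    · exact ⟨y, fun x hx e => (hy ⟨x, hx, e⟩).elim⟩
  choose f hf using hex
  obtain ⟨g, hg⟩ := Finset.exists_equiv_extend_of_card_eq (t := (univ : Finset Y)) (by simp)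
    (s := univ.filter fun y => ∃ x ∈ S, τ x = y) (f := f) (subset_univ _) (by
      intro y hy y' hy' e
      simp only [coe_filter, mem_univ, true_and, Set.mem_ofPred_eq] at hy hy'
      obtain ⟨x, hx, rfl⟩ := hy
      obtain ⟨x', hx', rfl⟩ := hy'
      rw [h x hx x' hx', hf _ x hx rfl, hf _ x' hx' rfl, e])
  refine ⟨g.trans (Equiv.subtypeUnivEquiv fun y => mem_univ y), fun x hx => ?_⟩
  rw [Equiv.trans_apply, Equiv.subtypeUnivEquiv_apply, hg _ (by simpa using ⟨x, hx, rfl⟩),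
    hf _ x hx rfl]

/-- Two maps with the same collisions on `S` agree there up to a permutation of `Y`, which the sum
over all relabellings absorbs. -/
theorem sum_perm_comp_eq {X Y : Type*} [Fintype Y] [DecidableEq Y] {S : Set X}
    {φ : (X → Y) → ℝ} (hφ : DependsOn φ S) {τ τ' : X → Y}
    (h : ∀ x ∈ S, ∀ x' ∈ S, τ x = τ x' ↔ τ' x = τ' x') :
    ∑ g : Equiv.Perm Y, φ (g ∘ τ) = ∑ g : Equiv.Perm Y, φ (g ∘ τ') := by
  obtain ⟨k, hk⟩ := exists_perm_comp_eqOn h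
  rw [← Equiv.sum_comp (Equiv.mulRight k) fun g : Equiv.Perm Y => φ (g ∘ τ)]
  refine sum_congr rfl fun g _ => hφ fun x hx => ?_
  simp [hk x hx]

instance {T : Type*} [Finite T] : Finite (Setoid T) :=
  Finite.of_injective (fun K : Setoid T => K.r) fun K L h => Setoid.ext fun a b => by
    have := congrFun (congrFun h a) b
    exact iff_of_eq this

-- A map with kernel `K` is an embedding of the quotient by `K`.
open Classical in
theorem card_filter_ker_eq {T : Type*} [Fintype T] [DecidableEq T] (r : ℕ) (K : Setoid T) :
    ((univ : Finset (T → Fin r)).filter fun ρ => Setoid.ker ρ = K).card =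
      r.descFactorial (Fintype.card (Quotient K)) := by
  rw [← Fintype.card_subtype]
  have e : {ρ : T → Fin r // Setoid.ker ρ = K} ≃ (Quotient K ↪ Fin r) :=
    { toFun := fun ρ => ⟨Quotient.lift ρ.1 fun a b hab => by
          have : Setoid.ker ρ.1 a b := by rw [ρ.2]; exact hab
          exact this, by
        rintro ⟨a⟩ ⟨b⟩ hab
        refine Quotient.sound ?_
        have : Setoid.ker ρ.1 a b := hab
        rw [ρ.2] at this
        exact this⟩
      invFun := fun g => ⟨fun t => g (Quotient.mk K t), Setoid.ext fun a b => by
        rw [Setoid.ker_def, g.injective.eq_iff]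
        exact Quotient.eq⟩
      left_inv := fun ρ => rfl
      right_inv := fun g => by ext ⟨a⟩; rfl }
  rw [Fintype.card_congr e, Fintype.card_embedding_eq, Fintype.card_fin]

open Classical in
theorem sum_comp_ker {T : Type*} [Fintype T] [DecidableEq T] [Fintype (Setoid T)] (r : ℕ) (G : Setoid T → ℝ) :
    ∑ ρ : T → Fin r, G (Setoid.ker ρ) =
      ∑ K : Setoid T, G K * (r.descFactorial (Fintype.card (Quotient K)) : ℝ) := by
  rw [← sum_fiberwise (univ : Finset (T → Fin r)) fun ρ => Setoid.ker ρ]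
  refine sum_congr rfl fun K _ => ?_
  rw [← card_filter_ker_eq, sum_congr rfl (g := fun _ => G K), sum_const, nsmul_eq_mul, mul_comm]
  intro ρ hρ
  rw [(mem_filter.1 hρ).2]

theorem sum_comp_restrict {X Z : Type*} [Fintype X] [DecidableEq X] [Fintype Z]
    (S : Finset X) (G : (S → Z) → ℝ) :
    ∑ ρ : X → Z, G (fun x => ρ x) =
      (Fintype.card Z : ℝ) ^ (Fintype.card X - S.card) * ∑ ρ : S → Z, G ρ := by
  rw [← (Equiv.piEquivPiSubtypeProd (· ∈ S) fun _ => Z).symm.sum_comp, Fintype.sum_prod_type,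
    mul_sum]
  refine sum_congr rfl fun ρ _ => ?_
  have : ∀ σ : {x // x ∉ S} → Z,
      G (fun x => (Equiv.piEquivPiSubtypeProd (· ∈ S) fun _ => Z).symm (ρ, σ) x) = G ρ := by
    intro σ
    congr 1
    ext x
    simp
  rw [sum_congr rfl fun σ _ => this σ, sum_const, nsmul_eq_mul, card_univ, Fintype.card_fun]
  simp [Fintype.card_subtype_compl]

/-- `descFactorial r c / r ^ s` as a polynomial in `1 / r`. -/
def descPoly (s c : ℕ) : ℝ[X] := X ^ (s - c) * ∏ i ∈ range c, (1 - C (i : ℝ) * X)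

theorem natDegree_descPoly_le {s c : ℕ} (h : c ≤ s) : (descPoly s c).natDegree ≤ s := by
  refine natDegree_mul_le.trans ?_
  have h₁ : (∏ i ∈ range c, (1 - C (i : ℝ) * X)).natDegree ≤ c := by
    refine (natDegree_prod_le _ _).trans ((sum_le_card_nsmul _ _ 1 fun i _ => ?_).trans (by simp))
    refine (natDegree_sub_le _ _).trans ?_
    refine max_le (by simp) ((natDegree_C_mul_le _ _).trans (by simp))
  rw [natDegree_X_pow]
  lia

theorem eval_descPoly {s c : ℕ} (h : c ≤ s) (r : ℕ) (hr : 1 ≤ r) :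
    (descPoly s c).eval (1 / (r : ℝ)) = (r.descFactorial c : ℝ) / (r : ℝ) ^ s := by
  have hr₀ : (r : ℝ) ≠ 0 := by positivity
  have h₁ : (r.descFactorial c : ℝ) = ∏ i ∈ range c, ((r : ℝ) - i) := by
    rw [← descPochhammer_eval_eq_descFactorial, descPochhammer_eval_eq_prod_range]
  have h₂ : ∏ i ∈ range c, (1 - (i : ℝ) * (1 / r)) = (∏ i ∈ range c, ((r : ℝ) - i)) / r ^ c := by
    rw [← card_range c, ← prod_const, card_range, ← prod_div_distrib]
    refine prod_congr rfl fun i _ => ?_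
    field_simp
  rw [descPoly, eval_mul, eval_pow, eval_X, eval_prod]
  simp only [eval_sub, eval_one, eval_mul, eval_C, eval_X]
  rw [h₂, h₁]
  obtain ⟨t, rfl⟩ := Nat.exists_eq_add_of_le h
  rw [Nat.add_sub_cancel_left, pow_add, one_div, inv_pow]
  field_simp

theorem eval_zero_descPoly {s c : ℕ} (h : c ≤ s) :
    (descPoly s c).eval 0 = if c = s then 1 else 0 := by
  rw [descPoly, eval_mul, eval_pow, eval_X, eval_prod]
  simp only [eval_sub, eval_one, eval_mul, eval_C, eval_X, mul_zero, sub_zero, prod_const_one,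
    mul_one]
  split_ifs with e
  · simp [e]
  · exact zero_pow (by lia)

/-- A map sending each `ρ` to a function with the same collisions. -/
def SameKer {X Y Z : Type*} (τ : (X → Z) → X → Y) : Prop :=
  ∀ ρ x x', τ ρ x = τ ρ x' ↔ ρ x = ρ x'

/-- Each class goes to the image of a chosen representative. At most as many values as points are
used, so `Z` may be larger than `Y`; this matters because the polynomial must be controlled at every
`1 / r`. -/
theorem exists_sameKer {X Y : Type*} (Z : Type*) {ι : X → Y} (hι : ι.Injective) :
    ∃ τ : (X → Z) → X → Y, SameKer τ := by
  refine ⟨fun ρ x => ι (Quotient.out (Quotient.mk (Setoid.ker ρ) x)), fun ρ x x' => ?_⟩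
  rw [hι.eq_iff, Quotient.out_inj, Quotient.eq]
  exact Setoid.ker_def

/-- The relabelled average depends only on the collision pattern `K` on `S`. Weighting it by the
probability of `K` gives the polynomial; at `0` only the pattern without collisions survives. -/
theorem exists_poly_of_dependsOn {X Y : Type*} [Fintype X] [Fintype Y] [DecidableEq X]
    [DecidableEq Y]
    {ι : X → Y} (hι : ι.Injective) {S : Finset X} {φ : (X → Y) → ℝ} (hφ : DependsOn φ (S : Set X)) :
    ∃ P : ℝ[X], P.natDegree ≤ S.card ∧ P.eval 0 = ∑ g : Equiv.Perm Y, φ (g ∘ ι) ∧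
      ∀ r : ℕ, 1 ≤ r → ∀ τ : (X → Fin r) → X → Y, SameKer τ →
        P.eval (1 / (r : ℝ)) =
          (∑ ρ, ∑ g : Equiv.Perm Y, φ (g ∘ τ ρ)) / (r : ℝ) ^ Fintype.card X := by
  classical
  have : Fintype (Setoid S) := Fintype.ofFinite _
  -- A model map with collision pattern `K` on `S`; its values off `S` do not affect `φ`.
  let τ₀ : Setoid S → X → Y := fun K x => if h : x ∈ S then ι (Quotient.mk K ⟨x, h⟩).out else ι x
  have hτ₀ : ∀ K : Setoid S, ∀ x (hx : x ∈ S) x' (hx' : x' ∈ S),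
      τ₀ K x = τ₀ K x' ↔ K ⟨x, hx⟩ ⟨x', hx'⟩ := by
    intro K x hx x' hx'
    simp only [τ₀, hx, hx', dif_pos]
    rw [hι.eq_iff, ← Subtype.ext_iff, Quotient.out_inj, Quotient.eq]
  let ψ : Setoid S → ℝ := fun K => ∑ g : Equiv.Perm Y, φ (g ∘ τ₀ K)
  have hc : ∀ K : Setoid S, Fintype.card (Quotient K) ≤ S.card := fun K => by
    simpa using Fintype.card_quotient_le K
  refine ⟨∑ K : Setoid S, C (ψ K) * descPoly S.card (Fintype.card (Quotient K)), ?_, ?_, ?_⟩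
  · exact natDegree_sum_le_of_forall_le _ _ fun K _ =>
      (natDegree_C_mul_le _ _).trans (natDegree_descPoly_le (hc K))
  · rw [eval_finsetSum, sum_eq_single (⊥ : Setoid S)]
    · have : Fintype.card (Quotient (⊥ : Setoid S)) = S.card := by
        have : Function.Bijective (Quotient.mk (⊥ : Setoid S)) :=
          ⟨fun a b h => Quotient.eq.1 h, Quotient.mk_surjective⟩
        rw [← Fintype.card_of_bijective this, Fintype.card_coe]
      rw [eval_mul, eval_C, eval_zero_descPoly (hc _), if_pos this, mul_one]
      refine sum_perm_comp_eq hφ fun x hx x' hx' => ?_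
      rw [hτ₀ _ x hx x' hx', hι.eq_iff]
      exact Subtype.mk_eq_mk
    · intro K _ hK
      rw [eval_mul, eval_C, eval_zero_descPoly (hc _), if_neg, mul_zero]
      intro h
      have hb : Function.Bijective (Quotient.mk K) :=
        (Fintype.bijective_iff_surjective_and_card _).2 ⟨Quotient.mk_surjective, by simp [h]⟩
      exact hK (eq_bot_iff.2 fun a b hab => hb.1 (Quotient.sound hab))
    · simp
  · intro r hr τ hτ
    have h₁ : ∀ ρ : X → Fin r, ∑ g : Equiv.Perm Y, φ (g ∘ τ ρ) =
        ψ (Setoid.ker fun x : S => ρ x) := fun ρ =>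
      sum_perm_comp_eq hφ fun x hx x' hx' => by
        rw [hτ₀ _ x hx x' hx', hτ ρ, Setoid.ker_def]
    rw [sum_congr rfl fun ρ _ => h₁ ρ,
      sum_comp_restrict S fun ρ : S → Fin r => ψ (Setoid.ker ρ), sum_comp_ker, Fintype.card_fin,
      eval_finsetSum, mul_sum, sum_div]
    refine sum_congr rfl fun K _ => ?_
    rw [eval_mul, eval_C, eval_descPoly (hc K) r hr]
    have hr₀ : (r : ℝ) ≠ 0 := by positivity
    obtain ⟨t, ht⟩ := Nat.exists_eq_add_of_le (card_le_univ S)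
    rw [ht, Nat.add_sub_cancel_left, pow_add]
    field_simp

theorem exists_poly_of_mem_juntaSum {X Y : Type*} [Fintype X] [Fintype Y] [DecidableEq X]
    [DecidableEq Y]
    {ι : X → Y} (hι : ι.Injective) {d : ℕ} {φ : (X → Y) → ℝ} (hφ : φ ∈ juntaSum X Y ℝ d) :
    ∃ P : ℝ[X], P.natDegree ≤ d ∧ P.eval 0 = ∑ g : Equiv.Perm Y, φ (g ∘ ι) ∧
      ∀ r : ℕ, 1 ≤ r → ∀ τ : (X → Fin r) → X → Y, SameKer τ →
        P.eval (1 / (r : ℝ)) =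
          (∑ ρ, ∑ g : Equiv.Perm Y, φ (g ∘ τ ρ)) / (r : ℝ) ^ Fintype.card X := by
  induction hφ using AddSubmonoid.closure_induction with
  | mem φ h =>
    obtain ⟨S, hS, h⟩ := h
    obtain ⟨P, h₁, h₂⟩ := exists_poly_of_dependsOn hι h
    exact ⟨P, h₁.trans hS, h₂⟩
  | zero => exact ⟨0, by simp⟩
  | add φ ψ _ _ h₁ h₂ =>
    obtain ⟨P, a₁, a₂, a₃⟩ := h₁
    obtain ⟨Q, b₁, b₂, b₃⟩ := h₂
    refine ⟨P + Q, (natDegree_add_le _ _).trans (max_le a₁ b₁), ?_, ?_⟩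
    · simp [a₂, b₂, sum_add_distrib]
    · intro r hr τ hτ
      rw [eval_add, a₃ r hr τ hτ, b₃ r hr τ hτ]
      simp [sum_add_distrib, add_div]

/-- Sums of juntas barely distinguish a randomly relabelled injective function from a randomly
relabelled random function with `N` potential values. -/
theorem abs_avg_sub_avg_le {X Y : Type*} [Fintype X] [Fintype Y] [DecidableEq X] [DecidableEq Y]
    {ι : X → Y} (hι : ι.Injective) {d : ℕ} {φ : (X → Y) → ℝ} (hφ : φ ∈ juntaSum X Y ℝ d)
    (h₀ : ∀ F, 0 ≤ φ F) (h₁ : ∀ F, φ F ≤ 1) (N : ℕ) (hN : 1 ≤ N)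
    (τ : (X → Fin N) → X → Y) (hτ : SameKer τ) :
    |(∑ ρ, ∑ g : Equiv.Perm Y, φ (g ∘ τ ρ)) / (N : ℝ) ^ Fintype.card X / (Fintype.card Y).factorial -
      (∑ g : Equiv.Perm Y, φ (g ∘ ι)) / (Fintype.card Y).factorial| ≤ 16 * (d : ℝ) ^ 3 / N := by
  obtain ⟨P, p₁, p₂, p₃⟩ := exists_poly_of_mem_juntaSum hι hφ
  set n : ℝ := ((Fintype.card Y).factorial : ℝ) with hn
  have hn₀ : 0 < n := by positivity
  have hev : ∀ x, (C n⁻¹ * P).eval x = P.eval x / n := fun x => by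
    rw [eval_mul, eval_C]; ring
  have := abs_eval_one_div_sub_eval_zero_le (p := C n⁻¹ * P)
    ((natDegree_C_mul_le _ _).trans p₁) (fun r hr => ?_) N hN
  · rwa [hev, hev, p₂, p₃ N hN τ hτ] at this
  · obtain ⟨τ', hτ'⟩ := exists_sameKer (Fin r) hι
    have hr₀ : (0 : ℝ) < r := by exact_mod_cast hr
    rw [hev, p₃ r hr τ' hτ']
    constructor
    · have := sum_nonneg fun ρ (_ : ρ ∈ univ) =>
        sum_nonneg fun (g : Equiv.Perm Y) (_ : g ∈ univ) => h₀ (g ∘ τ' ρ)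
      positivity
    · rw [div_div, div_le_one (by positivity)]
      calc _ ≤ ∑ ρ : X → Fin r, ∑ g : Equiv.Perm Y, (1 : ℝ) :=
            sum_le_sum fun ρ _ => sum_le_sum fun g _ => h₁ _
        _ = _ := by simp [Fintype.card_perm, hn]

end QuantumQuery

end

/-! ### The hybrid argument for the lower bound. -/

noncomputable section

open Finset BigOperators

theorem Fintype.abs_expect_sub_expect_le {ι : Type*} [Fintype ι] [Nonempty ι] {u v : ι → ℝ} {δ : ℝ}
    (h : ∀ i, |u i - v i| ≤ δ) : |𝔼 i, u i - 𝔼 i, v i| ≤ δ := by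
  rw [← expect_sub_distrib]
  exact (abs_expect_le _ _).trans (expect_le univ_nonempty fun i _ => h i)

/-- Each `act g` permutes `S`, so averaging over `g` first does not change the average over `S`. No
group law is needed. -/
theorem Finset.expect_eq_of_forall_expect_eq {Ω G : Type*} [Fintype G] [Nonempty G] (S : Finset Ω)
    (hS : S.Nonempty) (act : G → Equiv.Perm Ω) (hact : ∀ g s, s ∈ S ↔ act g s ∈ S) (f : Ω → ℝ) (c : ℝ)
    (h : ∀ s ∈ S, 𝔼 g, f (act g s) = c) : 𝔼 s ∈ S, f s = c := by
  have h₁ : ∀ g, 𝔼 s ∈ S, f (act g s) = 𝔼 s ∈ S, f s := fun g =>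
    expect_equiv (act g) (hact g) fun _ _ => rfl
  calc 𝔼 s ∈ S, f s = 𝔼 g : G, 𝔼 s ∈ S, f (act g s) := by simp only [h₁, Fintype.expect_const]
    _ = 𝔼 s ∈ S, 𝔼 g : G, f (act g s) := expect_comm _ _ _
    _ = 𝔼 s ∈ S, c := expect_congr rfl h
    _ = c := expect_const hS _

namespace SetEquality

open QuantumQuery

/-- A uniform function `[N] → [N]` remains uniform under relabelling, so the average over
relabellings drops out; relabelling the identity gives a random permutation. -/
theorem abs_expect_function_sub_expect_perm_le {N d : ℕ} (hN : 1 ≤ N)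
    {φ : (Fin N → Fin N) → ℝ} (hφ : φ ∈ juntaSum (Fin N) (Fin N) ℝ d)
    (h₀ : ∀ F, 0 ≤ φ F) (h₁ : ∀ F, φ F ≤ 1) :
    |𝔼 ρ, φ ρ - 𝔼 g : Equiv.Perm (Fin N), φ g| ≤ 16 * (d : ℝ) ^ 3 / N := by
  have key := abs_avg_sub_avg_le Function.injective_id hφ h₀ h₁ N hN id fun _ _ _ => Iff.rfl
  have e : ∑ ρ : Fin N → Fin N, ∑ g : Equiv.Perm (Fin N), φ (g ∘ id ρ) =
      (N.factorial : ℝ) * ∑ ρ, φ ρ := by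
    rw [sum_comm, sum_congr rfl (g := fun _ => ∑ ρ, φ ρ)]
    · simp [Fintype.card_perm]
    · intro g _
      exact (Equiv.arrowCongr (Equiv.refl (Fin N)) g).sum_comp φ
  rw [e] at key
  rw [Fintype.expect_eq_sum_div_card, Fintype.expect_eq_sum_div_card]
  simp only [Fintype.card_perm, Fintype.card_fin, Function.comp_id, Fintype.card_fun,
    Nat.cast_pow] at key ⊢
  convert key using 3
  field_simp

section

variable {N M : ℕ}

theorem mem_equalPairs {p : (Fin N ↪ Fin M) × (Fin N ↪ Fin M)} :
    p ∈ equalPairs N M ↔ Set.range p.1 = Set.range p.2 := by simp [equalPairs]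

theorem mem_disjointPairs {p : (Fin N ↪ Fin M) × (Fin N ↪ Fin M)} :
    p ∈ disjointPairs N M ↔ Disjoint (Set.range p.1) (Set.range p.2) := by simp [disjointPairs]

theorem equalPairs_nonempty (hM : N ≤ M) : (equalPairs N M).Nonempty :=
  ⟨((Fin.castLEEmb hM), (Fin.castLEEmb hM)), mem_equalPairs.2 rfl⟩

/-- An injective function `[N] ⊕ [N] → [M]`. -/
def sumEmb (hM : 2 * N ≤ M) : Fin N ⊕ Fin N ↪ Fin M :=
  finSumFinEquiv.toEmbedding.trans (Fin.castLEEmb (by lia))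

theorem disjointPairs_nonempty (hM : 2 * N ≤ M) : (disjointPairs N M).Nonempty := by
  refine ⟨(Function.Embedding.inl.trans (sumEmb hM), Function.Embedding.inr.trans (sumEmb hM)),
    mem_disjointPairs.2 ?_⟩
  rw [Set.disjoint_left]
  rintro _ ⟨a, rfl⟩ ⟨b, h⟩
  exact Sum.inr_ne_inl ((sumEmb hM).injective h)

theorem avgAcceptProb_eq_expect [NeZero M] (A : PairAlgorithm N M)
    (S : Finset ((Fin N ↪ Fin M) × (Fin N ↪ Fin M))) :
    avgAcceptProb A S = 𝔼 p ∈ S, pairAcceptProb A p := (expect_eq_sum_div_card _ _).symm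

theorem range_congr (σ : Equiv.Perm (Fin N)) (π : Equiv.Perm (Fin M)) (f : Fin N ↪ Fin M) :
    Set.range (Equiv.embeddingCongr σ π f) = π '' Set.range f := by
  ext y
  simp only [Equiv.embeddingCongr_apply, Set.mem_range, Set.mem_image, exists_exists_eq_and]
  constructor
  · rintro ⟨x, rfl⟩; exact ⟨σ.symm x, by simp [Function.Embedding.congr]⟩
  · rintro ⟨x, rfl⟩; exact ⟨σ x, by simp [Function.Embedding.congr]⟩

theorem avgAcceptProb_disjointPairs [NeZero M] (hM : 2 * N ≤ M) (A : PairAlgorithm N M) :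
    avgAcceptProb A (disjointPairs N M) =
      𝔼 g : Equiv.Perm (Fin M), A.acceptProb (g ∘ sumEmb hM) := by
  rw [avgAcceptProb_eq_expect]
  refine expect_eq_of_forall_expect_eq _ (disjointPairs_nonempty hM)
    (fun g : Equiv.Perm (Fin M) => (Equiv.embeddingCongr (Equiv.refl _) g).prodCongr
      (Equiv.embeddingCongr (Equiv.refl _) g)) ?_ _ _ ?_
  · intro g s
    rw [mem_disjointPairs, mem_disjointPairs]
    simp only [Equiv.prodCongr_apply, Prod.map_fst, Prod.map_snd, range_congr]
    exact (Set.disjoint_image_iff g.injective).symm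
  · intro s hs
    rw [mem_disjointPairs, Set.disjoint_left] at hs
    have hinj : Function.Injective (Sum.elim s.1 s.2 : Fin N ⊕ Fin N → Fin M) :=
      Function.Injective.sumElim s.1.injective s.2.injective fun a b h =>
        hs ⟨a, rfl⟩ ⟨b, h.symm⟩
    obtain ⟨k, hk⟩ := exists_perm_comp_eqOn (S := Set.univ) (τ := sumEmb hM)
      (τ' := (Sum.elim s.1 s.2 : Fin N ⊕ Fin N → Fin M)) fun x _ x' _ => by
        rw [(sumEmb hM).injective.eq_iff, hinj.eq_iff]
    refine Fintype.expect_equiv (Equiv.mulRight k) _ _ fun g => ?_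
    rw [pairAcceptProb]
    congr 1
    ext1 x
    simp only [Equiv.coe_mulRight, Equiv.Perm.coe_mul, Function.comp_apply, hk x trivial]
    cases x <;> rfl

/-- For an equal pair, the first function is `k ∘ e` and the second differs from it by a permutation
`σ` of the inputs. Both `k` and `σ` are absorbed into the random permutations. -/
theorem avgAcceptProb_equalPairs [NeZero M] (e : Fin N ↪ Fin M) (A : PairAlgorithm N M) :
    avgAcceptProb A (equalPairs N M) =
      𝔼 σ₂ : Equiv.Perm (Fin N), 𝔼 σ₁ : Equiv.Perm (Fin N), 𝔼 g : Equiv.Perm (Fin M),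
        A.acceptProb (g ∘ e ∘ Sum.elim σ₁ σ₂) := by
  rw [avgAcceptProb_eq_expect]
  refine expect_eq_of_forall_expect_eq _ ⟨(e, e), mem_equalPairs.2 rfl⟩
    (fun g : Equiv.Perm (Fin N) × Equiv.Perm (Fin N) × Equiv.Perm (Fin M) =>
      (Equiv.embeddingCongr g.2.1.symm g.2.2).prodCongr
      (Equiv.embeddingCongr g.1.symm g.2.2)) ?_ _ _ ?_
  · intro g s
    rw [mem_equalPairs, mem_equalPairs]
    simp only [Equiv.prodCongr_apply, Prod.map_fst, Prod.map_snd, range_congr]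
    exact (Set.image_injective.2 g.2.2.injective).eq_iff.symm
  · intro s hs
    rw [mem_equalPairs] at hs
    obtain ⟨k, hk⟩ := exists_perm_comp_eqOn (S := Set.univ) (τ := e) (τ' := s.1)
      fun x _ x' _ => by rw [e.injective.eq_iff, s.1.injective.eq_iff]
    let σ : Equiv.Perm (Fin N) := (Equiv.ofInjective s.2 s.2.injective).trans
      ((Equiv.setCongr hs.symm).trans (Equiv.ofInjective s.1 s.1.injective).symm)
    have hσ : ∀ x, s.2 x = s.1 (σ x) := fun x => by
      have := Equiv.apply_ofInjective_symm s.1.injective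
        (Equiv.setCongr hs.symm (Equiv.ofInjective s.2 s.2.injective x))
      exact this.symm
    rw [← univ_product_univ, expect_product]
    refine Fintype.expect_equiv (Equiv.mulLeft σ) _ _ fun σ₂ => ?_
    rw [← univ_product_univ, expect_product]
    refine expect_congr rfl fun σ₁ _ => ?_
    refine Fintype.expect_equiv (Equiv.mulRight k) _ _ fun g => ?_
    rw [pairAcceptProb]
    congr 1
    ext1 x
    cases x with
    | inl x =>
      change g (s.1 (σ₁ x)) = g (k (e (σ₁ x)))
      rw [hk _ trivial]
    | inr x =>
      change g (s.2 (σ₂ x)) = g (k (e (σ (σ₂ x))))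
      rw [hk _ trivial, hσ]

/-- `q` queries distinguish equal from disjoint ranges with advantage `O(q ^ 3 / N)`. -/
theorem advantage_le [NeZero M] (hN : 1 ≤ N) (hM : 2 * N ≤ M) (A : PairAlgorithm N M) :
    advantage A ≤ 384 * (A.queries : ℝ) ^ 3 / N := by
  have : NeZero N := ⟨by lia⟩
  let e : Fin N ↪ Fin M := Fin.castLEEmb (by lia)
  let d := 2 * A.queries
  let Ψ : (Fin N ⊕ Fin N → Fin N) → ℝ := fun F => 𝔼 g : Equiv.Perm (Fin M), A.acceptProb (g ∘ e ∘ F)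
  have hΨ₀ : ∀ F, 0 ≤ Ψ F := fun F => expect_nonneg fun g _ => A.acceptProb_nonneg _
  have hΨ₁ : ∀ F, Ψ F ≤ 1 := fun F => expect_le univ_nonempty fun g _ => A.acceptProb_le_one _
  have hΨ : Ψ ∈ juntaSum (Fin N ⊕ Fin N) (Fin N) ℝ d := by
    have h₁ : (∑ g : Equiv.Perm (Fin M), fun F : Fin N ⊕ Fin N → Fin N => A.acceptProb (g ∘ e ∘ F)) ∈
        juntaSum (Fin N ⊕ Fin N) (Fin N) ℝ d :=
      sum_mem fun g _ => juntaSum_comp A.acceptProb_mem_juntaSum (fun F => g ∘ e ∘ F) (fun x => {x})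
        (fun x => Set.subsingleton_singleton) fun x F G h => by simp [h x rfl]
    have h₂ := juntaSum_map (AddMonoidHom.mulRight ((Fintype.card (Equiv.Perm (Fin M)) : ℝ)⁻¹)) h₁
    convert h₂ using 2 with F
    simp [Ψ, Fintype.expect_eq_sum_div_card, div_eq_mul_inv, sum_mul]
  let δ : ℝ := 16 * (d : ℝ) ^ 3 / N
  -- The first permutation becomes a random function while `σ₂` is held fixed; fixing part of the
  -- input keeps a sum of juntas. The next hybrid treats `σ₂` likewise.
  have s₁ : |𝔼 σ₂ : Equiv.Perm (Fin N), 𝔼 ρ₁ : Fin N → Fin N, Ψ (Sum.elim ρ₁ σ₂) -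
      𝔼 σ₂ : Equiv.Perm (Fin N), 𝔼 σ₁ : Equiv.Perm (Fin N), Ψ (Sum.elim σ₁ σ₂)| ≤ δ := by
    refine Fintype.abs_expect_sub_expect_le fun σ₂ => ?_
    refine abs_expect_function_sub_expect_perm_le (φ := fun ρ => Ψ (Sum.elim ρ σ₂)) hN ?_
      (fun _ => hΨ₀ _) fun _ => hΨ₁ _
    refine juntaSum_comp hΨ (fun ρ => Sum.elim ρ σ₂) (Sum.elim (fun x => {x}) fun _ => ∅) ?_ ?_
    · rintro (x | x) <;> simp
    · rintro (x | x) F G h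
      · exact h x rfl
      · rfl
  have s₂ : |𝔼 ρ₁ : Fin N → Fin N, 𝔼 ρ₂ : Fin N → Fin N, Ψ (Sum.elim ρ₁ ρ₂) -
      𝔼 ρ₁ : Fin N → Fin N, 𝔼 σ₂ : Equiv.Perm (Fin N), Ψ (Sum.elim ρ₁ σ₂)| ≤ δ := by
    refine Fintype.abs_expect_sub_expect_le fun ρ₁ => ?_
    refine abs_expect_function_sub_expect_perm_le (φ := fun ρ => Ψ (Sum.elim ρ₁ ρ)) hN ?_
      (fun _ => hΨ₀ _) fun _ => hΨ₁ _
    refine juntaSum_comp hΨ (fun ρ => Sum.elim ρ₁ ρ) (Sum.elim (fun _ => ∅) fun x => {x}) ?_ ?_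
    · rintro (x | x) <;> simp
    · rintro (x | x) F G h
      · rfl
      · exact h x rfl
  have s₃ : |𝔼 ρ : Fin N ⊕ Fin N → Fin N, Ψ ρ -
      𝔼 g : Equiv.Perm (Fin M), A.acceptProb (g ∘ sumEmb hM)| ≤ δ := by
    have key := abs_avg_sub_avg_le (sumEmb hM).injective A.acceptProb_mem_juntaSum
      A.acceptProb_nonneg A.acceptProb_le_one N hN (fun ρ => e ∘ ρ) fun ρ x x' => e.injective.eq_iff
    convert key using 2
    simp only [Ψ, Fintype.expect_eq_sum_div_card, Fintype.card_perm, Fintype.card_fin,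
      Fintype.card_fun, Nat.cast_pow, ← sum_div]
    rw [div_right_comm]
  have e₁ : 𝔼 ρ : Fin N ⊕ Fin N → Fin N, Ψ ρ =
      𝔼 ρ₁ : Fin N → Fin N, 𝔼 ρ₂ : Fin N → Fin N, Ψ (Sum.elim ρ₁ ρ₂) :=
    (Fintype.expect_equiv (Equiv.sumArrowEquivProdArrow _ _ _) _
      (fun p => Ψ (Sum.elim p.1 p.2)) fun ρ => by
        congr 1; ext1 x; cases x <;> rfl).trans (expect_product' univ univ fun ρ₁ ρ₂ =>
          Ψ (Sum.elim ρ₁ ρ₂))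
  have e₂ : 𝔼 ρ₁ : Fin N → Fin N, 𝔼 σ₂ : Equiv.Perm (Fin N), Ψ (Sum.elim ρ₁ σ₂) =
      𝔼 σ₂ : Equiv.Perm (Fin N), 𝔼 ρ₁ : Fin N → Fin N, Ψ (Sum.elim ρ₁ σ₂) := expect_comm _ _ _
  have e₃ : avgAcceptProb A (equalPairs N M) =
      𝔼 σ₂ : Equiv.Perm (Fin N), 𝔼 σ₁ : Equiv.Perm (Fin N), Ψ (Sum.elim σ₁ σ₂) :=
    avgAcceptProb_equalPairs e A
  -- Three hybrids of `16 * (2 * q) ^ 3 / N` each.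
  have hδ : 384 * (A.queries : ℝ) ^ 3 / N = δ + δ + δ := by
    simp only [δ, d]; push_cast; ring
  rw [advantage, e₃, avgAcceptProb_disjointPairs hM, hδ]
  rw [e₁] at s₃
  rw [e₂] at s₂
  rw [abs_le] at s₁ s₂ s₃ ⊢
  constructor <;> linarith only [s₁.1, s₁.2, s₂.1, s₂.2, s₃.1, s₃.2]

end

end SetEquality

end

/-! ### Superpositions of basis states and the unitaries acting on them. -/

noncomputable section

namespace QuantumQuery

open Finset

section Superposition

variable {ι I : Type} [Fintype ι]

open Classical in
/-- The superposition of the basis states `b x` with amplitudes `a x`. -/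
def superpos (b : ι → I) (a : ι → ℝ) : EuclideanSpace ℂ I :=
  WithLp.toLp 2 fun i => ∑ x, if b x = i then (a x : ℂ) else 0

open Classical in
theorem superpos_apply (b : ι → I) (a : ι → ℝ) (i : I) :
    superpos b a i = ∑ x, if b x = i then (a x : ℂ) else 0 := rfl

theorem superpos_apply_of_injective {b : ι → I} (hb : b.Injective) (a : ι → ℝ) (x : ι) :
    superpos b a (b x) = a x := by
  classical
  simp [superpos_apply, hb.eq_iff]

open Classical in
theorem sum_norm_sq_superpos {b : ι → I} (hb : b.Injective) (a : ι → ℝ) (T : Finset I) :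
    ∑ i ∈ T, ‖superpos b a i‖ ^ 2 = ∑ x, if b x ∈ T then a x ^ 2 else 0 := by
  have h : ∀ i, ‖superpos b a i‖ ^ 2 = ∑ x, if b x = i then a x ^ 2 else 0 := by
    intro i
    by_cases hi : ∃ x, b x = i
    · obtain ⟨x, rfl⟩ := hi
      rw [superpos_apply_of_injective hb]
      simp [hb.eq_iff]
    · have : ∀ x, b x ≠ i := fun x e => hi ⟨x, e⟩
      simp [superpos_apply, this]
  simp_rw [h]
  rw [sum_comm]
  simp

theorem norm_superpos [Fintype I] {b : ι → I} (hb : b.Injective) (a : ι → ℝ) (ha : ∑ x, a x ^ 2 = 1) :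
    ‖superpos b a‖ = 1 := by
  have h : ‖superpos b a‖ ^ 2 = 1 := by
    rw [EuclideanSpace.norm_sq_eq, sum_norm_sq_superpos hb]
    simpa using ha
  exact (pow_eq_one_iff_of_nonneg (norm_nonneg _) two_ne_zero).1 h

/-- The unitary that permutes the basis states. -/
def permUnitary [Fintype I] (σ : Equiv.Perm I) : EuclideanSpace ℂ I ≃ₗᵢ[ℂ] EuclideanSpace ℂ I :=
  LinearIsometryEquiv.piLpCongrLeft 2 ℂ ℂ σ

theorem permUnitary_superpos [Fintype I] (σ : Equiv.Perm I) (b : ι → I) (a : ι → ℝ) :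
    permUnitary σ (superpos b a) = superpos (σ ∘ b) a := by
  classical
  ext i
  simp [permUnitary, LinearIsometryEquiv.piLpCongrLeft_apply, Equiv.piCongrLeft'_apply,
    superpos_apply]
  refine sum_congr rfl fun x _ => ?_
  exact if_congr (Equiv.eq_symm_apply σ) rfl rfl

open Classical in
/-- The unitary that flips the sign of the basis states in `S`. -/
def phaseUnitary [Fintype I] (S : Set I) : EuclideanSpace ℂ I ≃ₗᵢ[ℂ] EuclideanSpace ℂ I :=
  LinearIsometryEquiv.piLpCongrRight 2 fun i =>
    if i ∈ S then LinearIsometryEquiv.neg ℂ else LinearIsometryEquiv.refl ℂ ℂ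

open Classical in
theorem phaseUnitary_superpos [Fintype I] (S : Set I) (b : ι → I) (a : ι → ℝ) :
    phaseUnitary S (superpos b a) = superpos b fun x => if b x ∈ S then -a x else a x := by
  ext i
  by_cases hi : i ∈ S
  · simp only [phaseUnitary, LinearIsometryEquiv.piLpCongrRight_apply, hi, if_true,
      LinearIsometryEquiv.coe_neg, superpos_apply, ← sum_neg_distrib]
    refine sum_congr rfl fun x _ => ?_
    split_ifs with h₁ h₂
    · simp
    · exact (h₂ (h₁ ▸ hi)).elim
    · simp
  · simp only [phaseUnitary, LinearIsometryEquiv.piLpCongrRight_apply, hi, if_false,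
      LinearIsometryEquiv.coe_refl, id, superpos_apply]
    refine sum_congr rfl fun x _ => ?_
    split_ifs with h₁ h₂
    · exact (hi (h₁ ▸ h₂)).elim
    · simp
    · simp

variable {K : Type}

/-- The vectors that are constant along the fibres `x ↦ e (x, k)`. -/
def fibreConstant (e : ι × K → I) : Submodule ℂ (EuclideanSpace ℂ I) where
  carrier := {v | ∀ x x' k, v (e (x, k)) = v (e (x', k))}
  zero_mem' := by simp
  add_mem' := fun {v w} hv hw x x' k => by simp [hv x x' k, hw x x' k]
  smul_mem' := fun c v hv x x' k => by simp [hv x x' k]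

/-- Inversion about the mean along the fibres `x ↦ e (x, k)`. -/
def diffusion [Fintype I] (e : ι × K → I) : EuclideanSpace ℂ I ≃ₗᵢ[ℂ] EuclideanSpace ℂ I :=
  (fibreConstant e).reflection

/-- The amplitudes split into their mean, which the reflection fixes, and a part of sum zero, which
is orthogonal to the subspace and changes sign. -/
theorem diffusion_superpos [Nonempty ι] [Fintype I] {e : ι × K → I} (he : e.Injective) (k : K) (a : ι → ℝ) :
    diffusion e (superpos (fun x => e (x, k)) a) =
      superpos (fun x => e (x, k)) fun x => 2 * ((∑ x', a x') / Fintype.card ι) - a x := by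
  classical
  set m : ℝ := (∑ x', a x') / Fintype.card ι with hm
  have hsum : ∑ x, (a x - m) = 0 := by
    rw [sum_sub_distrib, sum_const, card_univ, nsmul_eq_mul, hm, mul_div_cancel₀, sub_self]
    simp
  have h₁ : superpos (fun x => e (x, k)) (fun _ : ι => m) ∈ fibreConstant e := by
    intro x x' k'
    by_cases h : k = k' <;> simp [superpos_apply, he.eq_iff, h]
  have h₂ : superpos (fun x => e (x, k)) (fun x => a x - m) ∈ (fibreConstant e)ᗮ := by
    rw [Submodule.mem_orthogonal]
    intro v hv
    rw [PiLp.inner_apply]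
    have : ∀ i, inner ℂ (v i) (superpos (fun x => e (x, k)) (fun x => a x - m) i) =
        ∑ x, if e (x, k) = i then ((a x - m : ℝ) : ℂ) * (starRingEnd ℂ) (v i) else 0 := by
      intro i
      rw [superpos_apply, inner_sum]
      refine sum_congr rfl fun x _ => ?_
      split_ifs <;> simp
    simp_rw [this]
    rw [sum_comm]
    simp only [sum_ite_eq, mem_univ, if_true]
    obtain ⟨x₀⟩ := ‹Nonempty ι›
    simp_rw [hv _ x₀ k]
    rw [← sum_mul, ← Complex.ofReal_sum, hsum]
    simp
  have h₃ : superpos (fun x => e (x, k)) a = superpos (fun x => e (x, k)) (fun _ : ι => m) +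
      superpos (fun x => e (x, k)) (fun x => a x - m) := by
    ext i
    simp only [superpos_apply, PiLp.add_apply, ← sum_add_distrib]
    refine sum_congr rfl fun x _ => ?_
    split_ifs <;> simp
  rw [h₃, map_add, diffusion, Submodule.reflection_mem_subspace_eq_self h₁,
    Submodule.reflection_mem_subspace_orthogonalComplement_eq_neg h₂]
  ext i
  simp only [superpos_apply, PiLp.add_apply, PiLp.neg_apply, ← sum_neg_distrib, ← sum_add_distrib]
  refine sum_congr rfl fun x _ => ?_
  split_ifs
  · push_cast; ring
  · simp

end Superposition

theorem oracle_superpos {ι X Y W : Type} [Fintype ι] [Fintype X] [Fintype Y] [AddGroup Y]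
    [Fintype W] (F : X → Y) (b : ι → X × Y × W) (a : ι → ℝ) :
    oracle F (superpos b a) = superpos (oraclePerm F ∘ b) a :=
  permUnitary_superpos (oraclePerm F) b a

end QuantumQuery

end

/-! ### The search algorithm and its exact acceptance probability. -/

noncomputable section

namespace SetEquality

open QuantumQuery Finset

section Grover

variable {N M k : ℕ}

/-- The workspace: a list of `k` values and a spare query register. -/
abbrev GroverSpace (N M k : ℕ) : Type := (Fin k → Fin M) × (Fin N ⊕ Fin N)

/-- The basis states of the search algorithm. -/
abbrev GroverBasis (N M k : ℕ) : Type := (Fin N ⊕ Fin N) × Fin M × GroverSpace N M k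

/-- Exchange the response register with slot `n` of the list, and apply `P` to the two query
registers. -/
def storePerm (n : Fin k) (P : Equiv.Perm ((Fin N ⊕ Fin N) × (Fin N ⊕ Fin N))) :
    Equiv.Perm (GroverBasis N M k) where
  toFun i := ((P (i.1, i.2.2.2)).1, i.2.2.1 n,
    Function.update i.2.2.1 n i.2.1, (P (i.1, i.2.2.2)).2)
  invFun i := ((P.symm (i.1, i.2.2.2)).1, i.2.2.1 n,
    Function.update i.2.2.1 n i.2.1, (P.symm (i.1, i.2.2.2)).2)
  left_inv i := by simp
  right_inv i := by simp

/-- Negate the response register. -/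
def negPerm [NeZero M] : Equiv.Perm (GroverBasis N M k) :=
  (Equiv.refl _).prodCongr ((Equiv.neg (Fin M)).prodCongr (Equiv.refl _))

/-- The point of the first copy of `[N]` that is queried in step `n`. -/
def listPoint (hN : 0 < N) (n : ℕ) : Fin N := ⟨n % N, Nat.mod_lt _ hN⟩

/-- The permutation of the two query registers after step `n` of the first phase: move on to the
next point, and after the last step fetch the superposition from the spare register. -/
def advancePerm (hN : 0 < N) (k n : ℕ) : Equiv.Perm ((Fin N ⊕ Fin N) × (Fin N ⊕ Fin N)) :=
  if n + 1 < k then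
    (Equiv.swap (Sum.inl (listPoint hN n)) (Sum.inl (listPoint hN (n + 1)))).prodCongr
      (Equiv.refl _)
  else Equiv.prodComm _ _

/-- The basis states at which the value in the response register is in the list. -/
def listed (N M k : ℕ) : Set (GroverBasis N M k) := {i | i.2.1 ∈ Set.range i.2.2.1}

/-- The basis states with a query to the second function. -/
def searchBasis (N M k : ℕ) (j : Fin N × (Fin M × GroverSpace N M k)) : GroverBasis N M k :=
  (Sum.inr j.1, j.2)

theorem searchBasis_injective : (searchBasis N M k).Injective := by
  rintro ⟨x, y⟩ ⟨x', y'⟩ h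
  simpa [searchBasis] using h

/-- The unitaries of the search algorithm. -/
def groverUnitary [NeZero M] (hN : 0 < N) (k n : ℕ) :
    EuclideanSpace ℂ (GroverBasis N M k) ≃ₗᵢ[ℂ] EuclideanSpace ℂ (GroverBasis N M k) :=
  if h : n < k then permUnitary (storePerm ⟨n, h⟩ (advancePerm hN k n))
  else if Even (n - k) then (phaseUnitary (listed N M k)).trans (permUnitary negPerm)
  else diffusion (searchBasis N M k)

open Classical in
/-- The basis states at which the negative of the value in the response register is in the list. -/
def groverAccept (N M k : ℕ) [NeZero M] : Finset (GroverBasis N M k) :=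
  univ.filter fun i => -i.2.1 ∈ Set.range i.2.2.1

/-- Search for a value of `g` among `k` values of `f`, with `t` iterations of Grover search. -/
def groverAlgorithm [NeZero M] (hN : 0 < N) (k t : ℕ) : PairAlgorithm N M where
  W := GroverSpace N M k
  queries := k + (2 * t + 1)
  init := superpos (fun x : Fin N => (Sum.inl (listPoint hN 0), 0, fun _ => 0, Sum.inr x))
    fun _ => (√N)⁻¹
  norm_init := by
    refine norm_superpos (fun x x' h => by simpa using h) _ ?_
    simp [inv_pow, mul_inv_cancel₀ (by positivity : (N : ℝ) ≠ 0)]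
  U := groverUnitary hN k
  accept := groverAccept N M k

variable (hN : 0 < N) (t : ℕ) (f g : Fin N ↪ Fin M)

/-- The points whose value under `g` is among the first `k` values of `f`. -/
def marked (k : ℕ) : Set (Fin N) := {x | g x ∈ Set.range fun j : Fin k => f (listPoint hN j)}

open Classical in
theorem card_marked (hkN : k ≤ N) (h : Set.range f = Set.range g) :
    (univ.filter (· ∈ marked hN f g k)).card = k := by
  have hex : ∀ x, ∃ y, g y = f x := fun x => by
    have : f x ∈ Set.range g := h ▸ ⟨x, rfl⟩
    exact this
  choose σ hσ using hex
  have : univ.filter (· ∈ marked hN f g k) = univ.image fun j : Fin k => σ (listPoint hN j) := by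
    ext x
    simp only [mem_filter, mem_univ, true_and, mem_image, marked, Set.mem_ofPred_eq, Set.mem_range]
    refine exists_congr fun j => ?_
    rw [← hσ, g.injective.eq_iff]
  rw [this, card_image_of_injective, card_univ, Fintype.card_fin]
  intro i j hij
  have h₁ : f (listPoint hN i) = f (listPoint hN j) := by
    rw [← hσ, ← hσ]; exact congrArg g hij
  have h₂ := Fin.ext_iff.1 (f.injective h₁)
  simp only [listPoint] at h₂
  rw [Nat.mod_eq_of_lt (i.2.trans_le hkN), Nat.mod_eq_of_lt (j.2.trans_le hkN)] at h₂
  exact Fin.ext h₂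

variable [NeZero M]

/-- The list of values of `f` collected after `n` queries. -/
def collected (k n : ℕ) (j : Fin k) : Fin M := if (j : ℕ) < n then f (listPoint hN j) else 0

theorem groverAlgorithm_state_succ {n : ℕ} {F : Fin N ⊕ Fin N → Fin M} {b : Fin N → GroverBasis N M k}
    {a : Fin N → ℝ} (h : (groverAlgorithm hN k t).state F n = superpos b a) :
    (groverAlgorithm hN k t).state F (n + 1) =
      groverUnitary hN k n (superpos (oraclePerm F ∘ b) a) := by
  rw [Algorithm.state, h]
  exact congrArg (groverUnitary hN k n) (oracle_superpos F b a)

theorem update_collected (n : ℕ) (hn : n < k) :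
    Function.update (collected hN f k n) ⟨n, hn⟩ (f (listPoint hN n)) = collected hN f k (n + 1) := by
  ext1 j
  by_cases h : j = ⟨n, hn⟩
  · subst h; simp [collected]
  · have : (j : ℕ) ≠ n := fun e => h (Fin.ext e)
    rw [Function.update_of_ne h, collected, collected]
    congr 1
    exact propext (by lia)

/-- Slot `n` still holds its initial `0`, so the exchange both stores the queried value and clears
the response register. -/
theorem storePerm_oraclePerm (n : ℕ) (hn : n < k)
    (P : Equiv.Perm ((Fin N ⊕ Fin N) × (Fin N ⊕ Fin N))) (z : Fin N ⊕ Fin N) :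
    storePerm ⟨n, hn⟩ P (oraclePerm (Sum.elim f g)
      (Sum.inl (listPoint hN n), 0, collected hN f k n, z)) =
    ((P (Sum.inl (listPoint hN n), z)).1, 0, collected hN f k (n + 1),
      (P (Sum.inl (listPoint hN n), z)).2) := by
  simp [storePerm, oraclePerm, update_collected]
  simp [collected]

theorem groverAlgorithm_state_collect (n : ℕ) (hn : n < k) :
    (groverAlgorithm hN k t).state (Sum.elim f g) n =
      superpos (I := GroverBasis N M k) (fun x : Fin N =>
        (Sum.inl (listPoint hN n), 0, collected hN f k n, Sum.inr x)) fun _ => (√N)⁻¹ := by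
  induction n with
  | zero => rfl
  | succ n ih =>
    have hn' : n < k := by lia
    rw [groverAlgorithm_state_succ hN t (ih hn'), groverUnitary, dif_pos hn', permUnitary_superpos]
    congr 1
    ext1 x
    rw [Function.comp_apply, Function.comp_apply, storePerm_oraclePerm]
    simp [advancePerm, hn]

/-- The basis states in the second phase. -/
def phaseTwoBasis (k : ℕ) (x : Fin N) : GroverBasis N M k :=
  searchBasis N M k (x, (0, (fun j => f (listPoint hN j), Sum.inl (listPoint hN (k - 1)))))

theorem groverAlgorithm_state_collected (hk : 0 < k) :
    (groverAlgorithm hN k t).state (Sum.elim f g) k =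
      superpos (phaseTwoBasis hN f k) fun _ => (√N)⁻¹ := by
  obtain ⟨n, rfl⟩ : ∃ n, k = n + 1 := ⟨k - 1, by lia⟩
  have hn' : n < n + 1 := by lia
  rw [groverAlgorithm_state_succ hN t (groverAlgorithm_state_collect hN t f g n hn'),
    groverUnitary, dif_pos hn', permUnitary_superpos]
  congr 1
  ext1 x
  rw [Function.comp_apply, Function.comp_apply, storePerm_oraclePerm]
  simp only [advancePerm, lt_irrefl, if_false, Equiv.prodComm_apply, Prod.swap_prod_mk,
    phaseTwoBasis, searchBasis, Nat.add_sub_cancel]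
  congr 3
  ext1 j
  exact if_pos j.2

open Classical in
/-- Flip the sign of the amplitudes of the elements of `S`. -/
def flipAmp (S : Set (Fin N)) (a : Fin N → ℝ) (x : Fin N) : ℝ := if x ∈ S then -a x else a x

theorem flipAmp_of_mem {S : Set (Fin N)} {a : Fin N → ℝ} {x : Fin N} (hx : x ∈ S) :
    flipAmp S a x = -a x := if_pos hx

theorem flipAmp_of_notMem {S : Set (Fin N)} {a : Fin N → ℝ} {x : Fin N} (hx : x ∉ S) :
    flipAmp S a x = a x := if_neg hx

/-- The amplitudes after `t` iterations of Grover search. -/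
def groverAmp (S : Set (Fin N)) : ℕ → Fin N → ℝ
  | 0 => fun _ => (√N)⁻¹
  | t + 1 => fun x => 2 * ((∑ x', flipAmp S (groverAmp S t) x') / N) - flipAmp S (groverAmp S t) x

theorem groverAmp_succ (S : Set (Fin N)) (t : ℕ) (x : Fin N) : groverAmp S (t + 1) x =
    2 * ((∑ x', flipAmp S (groverAmp S t) x') / N) - flipAmp S (groverAmp S t) x := rfl

/-- The basis states between the two queries of a Grover iteration. -/
def halfwayBasis (k : ℕ) (x : Fin N) : GroverBasis N M k :=
  searchBasis N M k (x, (-g x, (fun j => f (listPoint hN j), Sum.inl (listPoint hN (k - 1)))))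

/-- The phase is applied while the response register holds `g x`. Negating it afterwards lets the
next query return the register to `0`, since only addition of `g x` is available. -/
theorem groverAlgorithm_flip (s : ℕ) (a : Fin N → ℝ)
    (h : (groverAlgorithm hN k t).state (Sum.elim f g) (k + 2 * s) =
      superpos (phaseTwoBasis hN f k) a) :
    (groverAlgorithm hN k t).state (Sum.elim f g) (k + 2 * s + 1) =
      superpos (halfwayBasis hN f g k) (flipAmp (marked hN f g k) a) := by
  have hU : groverUnitary hN k (k + 2 * s) =
      (phaseUnitary (listed N M k)).trans (permUnitary negPerm) := by
    rw [groverUnitary, dif_neg (by lia), if_pos (by simp)]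
  have hb : ∀ x, oraclePerm (Sum.elim f g) (phaseTwoBasis hN f k x) =
      searchBasis N M k
        (x, (g x, (fun j => f (listPoint hN j), Sum.inl (listPoint hN (k - 1))))) := fun x => by
    simp [phaseTwoBasis, searchBasis, oraclePerm]
  rw [groverAlgorithm_state_succ hN t h, hU, LinearIsometryEquiv.trans_apply, phaseUnitary_superpos,
    permUnitary_superpos]
  congr 1
  · ext1 x
    rw [Function.comp_apply, Function.comp_apply, hb]
    rfl
  · ext1 x
    rw [Function.comp_apply, hb]
    rfl

theorem groverAlgorithm_iterate (s : ℕ) (a : Fin N → ℝ)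
    (h : (groverAlgorithm hN k t).state (Sum.elim f g) (k + 2 * s + 1) =
      superpos (halfwayBasis hN f g k) a) :
    (groverAlgorithm hN k t).state (Sum.elim f g) (k + 2 * (s + 1)) =
      superpos (phaseTwoBasis hN f k) fun x => 2 * ((∑ x', a x') / N) - a x := by
  have : Nonempty (Fin N) := ⟨⟨0, hN⟩⟩
  rw [show k + 2 * (s + 1) = k + 2 * s + 1 + 1 by ring, groverAlgorithm_state_succ hN t h]
  have hU : groverUnitary (M := M) hN k (k + 2 * s + 1) = diffusion (searchBasis N M k) := by
    rw [groverUnitary, dif_neg (by lia), if_neg (by simp [add_assoc])]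
  have hb : oraclePerm (Sum.elim f g) ∘ halfwayBasis hN f g k = phaseTwoBasis hN f k := by
    ext1 x
    simp [halfwayBasis, phaseTwoBasis, searchBasis, oraclePerm]
  rw [hU, hb]
  have := diffusion_superpos (searchBasis_injective (N := N) (M := M) (k := k))
    (0, (fun j => f (listPoint hN j), Sum.inl (listPoint hN (k - 1)))) a
  rw [Fintype.card_fin] at this
  exact this

theorem groverAlgorithm_state_search (hk : 0 < k) (s : ℕ) :
    (groverAlgorithm hN k t).state (Sum.elim f g) (k + 2 * s) =
      superpos (phaseTwoBasis hN f k) (groverAmp (marked hN f g k) s) := by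
  induction s with
  | zero => exact groverAlgorithm_state_collected hN t f g hk
  | succ s ih => exact groverAlgorithm_iterate hN t f g s _ (groverAlgorithm_flip hN t f g s _ ih)

-- The extra final query writes `g x` once more, so the measurement reveals whether `x` is marked.
-- The sign flip that comes with it disappears on squaring.
open Classical in
theorem groverAlgorithm_acceptProb (hk : 0 < k) :
    pairAcceptProb (groverAlgorithm hN k t) (f, g) =
      ∑ x, if x ∈ marked hN f g k then groverAmp (marked hN f g k) t x ^ 2 else 0 := by
  rw [pairAcceptProb, Algorithm.acceptProb]
  have h := groverAlgorithm_flip hN t f g t _ (groverAlgorithm_state_search hN t f g hk t)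
  have hb : Function.Injective (halfwayBasis hN f g k) := fun x x' h =>
    (Prod.ext_iff.1 (searchBasis_injective h)).1
  have hs := sum_norm_sq_superpos hb (flipAmp (marked hN f g k) (groverAmp (marked hN f g k) t))
    (groverAccept N M k)
  rw [← h] at hs
  refine Eq.trans ?_ (hs.trans ?_)
  · rfl
  · refine sum_congr rfl fun x _ => ?_
    have : halfwayBasis hN f g k x ∈ groverAccept N M k ↔
        x ∈ marked hN f g k := by
      refine (mem_filter.trans (and_iff_right (mem_univ _))).trans ?_
      rw [halfwayBasis, searchBasis, neg_neg]
      rfl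
    by_cases hx : x ∈ marked hN f g k
    · rw [if_pos (this.2 hx), if_pos hx, flipAmp_of_mem hx, neg_sq]
    · rw [if_neg (mt this.1 hx), if_neg hx]

theorem groverAlgorithm_acceptProb_of_disjoint (hk : 0 < k)
    (h : Disjoint (Set.range f) (Set.range g)) :
    pairAcceptProb (groverAlgorithm hN k t) (f, g) = 0 := by
  classical
  rw [groverAlgorithm_acceptProb hN t f g hk]
  refine sum_eq_zero fun x _ => if_neg ?_
  rintro ⟨j, hj⟩
  exact Set.disjoint_left.1 h ⟨_, rfl⟩ ⟨x, hj.symm⟩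

open Classical in
/-- The amplitudes of Grover search for `k` marked elements. -/
theorem groverAmp_eq (S : Set (Fin N)) (hk : 0 < k) (hS : (univ.filter (· ∈ S)).card = k)
    {θ : ℝ} (hs : √N * Real.sin θ = √k) (hc : √N * Real.cos θ = √(N - k : ℝ)) (t : ℕ) (x : Fin N) :
    (x ∈ S → √k * groverAmp S t x = Real.sin ((2 * t + 1) * θ)) ∧
      (x ∉ S → √(N - k : ℝ) * groverAmp S t x = Real.cos ((2 * t + 1) * θ)) := by
  have hN₀ : (0 : ℝ) < N := by
    have := x.pos
    exact_mod_cast this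
  have hsN : 0 < √(N : ℝ) := Real.sqrt_pos.2 hN₀
  have hNN : √(N : ℝ) * √N = N := Real.mul_self_sqrt hN₀.le
  have hkN : (k : ℝ) ≤ N := by
    have : k ≤ N := by rw [← hS]; exact (card_le_univ _).trans (by simp)
    exact_mod_cast this
  have hcc : √(N - k : ℝ) * √(N - k : ℝ) = N - k := Real.mul_self_sqrt (by linarith)
  have hsk : 0 < √(k : ℝ) := Real.sqrt_pos.2 (by exact_mod_cast hk)
  have hS' : (univ.filter (· ∉ S)).card = N - k := by
    have := card_filter_add_card_filter_not (s := (univ : Finset (Fin N))) (· ∈ S)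
    rw [hS, card_univ, Fintype.card_fin] at this
    lia
  induction t generalizing x with
  | zero =>
    simp only [groverAmp, Nat.cast_zero, mul_zero, zero_add, one_mul]
    constructor
    · intro _
      rw [← hs]; field_simp
    · intro _
      rw [← hc]; field_simp
  | succ t ih =>
    set φ : ℝ := (2 * t + 1) * θ with hφ
    have hφ' : (2 * ((t + 1 : ℕ) : ℝ) + 1) * θ = φ + 2 * θ := by rw [hφ]; push_cast; ring
    -- After the flip, `k` amplitudes equal `-sin φ / √k` and `N - k` equal `cos φ / √(N - k)`; the
    -- hypotheses on `θ` turn their sum into an addition formula. An iteration thus advances the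
    -- angle by `2 * θ`.
    have hsum : ∑ x', flipAmp S (groverAmp S t) x' = √N * Real.cos (φ + θ) := by
      have h₁ : ∑ x ∈ univ.filter (· ∈ S), flipAmp S (groverAmp S t) x =
          -(√k * Real.sin φ) := by
        rw [sum_congr rfl (g := fun _ => -(Real.sin φ / √k)), sum_const, hS, nsmul_eq_mul]
        · rw [mul_neg, mul_div_assoc', ← div_mul_eq_mul_div, Real.div_sqrt]
        · intro x hx
          rw [flipAmp_of_mem (mem_filter.1 hx).2, ← (ih x).1 (mem_filter.1 hx).2]
          field_simp
      have h₂ : ∑ x ∈ univ.filter (· ∉ S), flipAmp S (groverAmp S t) x =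
          √(N - k : ℝ) * Real.cos φ := by
        rw [sum_congr rfl (g := fun _ => Real.cos φ / √(N - k : ℝ)), sum_const, hS', nsmul_eq_mul,
          Nat.cast_sub (by exact_mod_cast hkN)]
        · nth_rewrite 1 [← hcc]
          -- If every point is marked there is no unmarked amplitude, and both sides vanish.
          rcases eq_or_ne √(N - k : ℝ) 0 with h0 | h0
          · rw [h0]; simp
          · field_simp
        · intro x hx
          have hx' := (mem_filter.1 hx).2
          have hpos : 0 < (univ.filter (· ∉ S)).card := card_pos.2 ⟨x, hx⟩
          have : √(N - k : ℝ) ≠ 0 := by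
            have : (k : ℝ) < N := by
              have : k < N := by lia
              exact_mod_cast this
            exact (Real.sqrt_pos.2 (by linarith)).ne'
          rw [flipAmp_of_notMem hx', ← (ih x).2 hx']
          field_simp
      rw [← sum_filter_add_sum_filter_not univ (· ∈ S), h₁, h₂, ← hs, ← hc, Real.cos_add]
      ring
    have havg : (∑ x', flipAmp S (groverAmp S t) x') / N = Real.cos (φ + θ) / √N := by
      rw [hsum, div_eq_div_iff hN₀.ne' hsN.ne']; linear_combination Real.cos (φ + θ) * hNN
    rw [hφ']
    constructor
    · intro hx
      have e : √k * groverAmp S (t + 1) x =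
          2 * (√k * (Real.cos (φ + θ) / √N)) + √k * groverAmp S t x := by
        rw [groverAmp_succ, havg, flipAmp_of_mem hx]; ring
      rw [e, (ih x).1 hx, ← hs]
      have : √N * Real.sin θ * (Real.cos (φ + θ) / √N) = Real.sin θ * Real.cos (φ + θ) := by
        field_simp
      rw [this, Real.cos_add, Real.sin_add, Real.sin_two_mul, Real.cos_two_mul']
      linear_combination Real.sin φ * (-Real.cos_sq_add_sin_sq θ)
    · intro hx
      have e : √(N - k : ℝ) * groverAmp S (t + 1) x =
          2 * (√(N - k : ℝ) * (Real.cos (φ + θ) / √N)) - √(N - k : ℝ) * groverAmp S t x := by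
        rw [groverAmp_succ, havg, flipAmp_of_notMem hx]; ring
      rw [e, (ih x).2 hx, ← hc]
      have : √N * Real.cos θ * (Real.cos (φ + θ) / √N) = Real.cos θ * Real.cos (φ + θ) := by
        field_simp
      rw [this, Real.cos_add, Real.cos_add, Real.sin_two_mul, Real.cos_two_mul]
      ring

theorem groverAlgorithm_acceptProb_of_range_eq (hk : 0 < k) (hkN : k ≤ N)
    (h : Set.range f = Set.range g) :
    pairAcceptProb (groverAlgorithm hN k t) (f, g) =
      Real.sin ((2 * t + 1) * Real.arcsin √(k / N : ℝ)) ^ 2 := by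
  classical
  have hN₀ : (0 : ℝ) < N := by exact_mod_cast hN
  have hkN' : (k : ℝ) / N ≤ 1 := by rw [div_le_one hN₀]; exact_mod_cast hkN
  have hk₀ : (0 : ℝ) < √(k : ℝ) := Real.sqrt_pos.2 (by exact_mod_cast hk)
  have hs : √N * Real.sin (Real.arcsin √(k / N : ℝ)) = √k := by
    rw [Real.sin_arcsin (by linarith [Real.sqrt_nonneg (k / N : ℝ)]) (Real.sqrt_le_one.2 hkN'),
      ← Real.sqrt_mul hN₀.le, mul_div_cancel₀ _ hN₀.ne']
  have hc : √N * Real.cos (Real.arcsin √(k / N : ℝ)) = √(N - k : ℝ) := by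
    rw [Real.cos_arcsin, Real.sq_sqrt (by positivity), ← Real.sqrt_mul hN₀.le]
    congr 1
    field_simp
  rw [groverAlgorithm_acceptProb hN t f g hk, ← sum_filter]
  rw [sum_congr rfl (g := fun _ => (Real.sin ((2 * t + 1) * Real.arcsin √(k / N : ℝ)) / √k) ^ 2),
    sum_const, card_marked hN f g hkN h, nsmul_eq_mul, div_pow, Real.sq_sqrt (Nat.cast_nonneg _)]
  · have : (k : ℝ) ≠ 0 := by positivity
    field_simp
  · intro x hx
    rw [← (groverAmp_eq _ hk (card_marked hN f g hkN h) hs hc t x).1 (mem_filter.1 hx).2]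
    field_simp

end Grover

end SetEquality

end

/-! ### Query bounds for fixed error. -/

noncomputable section

namespace SetEquality

open QuantumQuery Finset

theorem Solves.distinguishes {N M : ℕ} [NeZero M] (hM : 2 * N ≤ M) {A : PairAlgorithm N M} {ε : ℝ}
    (h : Solves A ε) : Distinguishes A ε := by
  rw [Distinguishes, avgAcceptProb_eq_expect, avgAcceptProb_eq_expect]
  exact ⟨le_expect (equalPairs_nonempty (by lia)) fun p hp => h.1 p hp,
    expect_le (disjointPairs_nonempty hM) fun p hp => h.2 p hp⟩

theorem le_queries_of_distinguishes {N M : ℕ} [NeZero M] (hN : 1 ≤ N) (hM : 2 * N ≤ M) {ε : ℝ}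
    (hε : ε < 1 / 2) {A : PairAlgorithm N M} (h : Distinguishes A ε) :
    ((1 - 2 * ε) / 384) ^ (1 / 3 : ℝ) * (N : ℝ) ^ (1 / 3 : ℝ) ≤ A.queries := by
  have hN₀ : (0 : ℝ) < N := by exact_mod_cast hN
  have h₁ : 1 - 2 * ε ≤ advantage A :=
    le_trans (by linarith [h.1, h.2]) (le_abs_self _)
  have h₂ := h₁.trans (advantage_le hN hM A)
  rw [le_div_iff₀ hN₀] at h₂
  rw [← Real.mul_rpow (by linarith) hN₀.le]
  calc _ ≤ ((A.queries : ℝ) ^ 3) ^ (1 / 3 : ℝ) :=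
        Real.rpow_le_rpow (mul_nonneg (by linarith) hN₀.le) (by linarith) (by norm_num)
    _ = _ := by
        rw [← Real.rpow_natCast, ← Real.rpow_mul (Nat.cast_nonneg _)]
        norm_num

/-- Choosing `t = ⌊π / (4 * θ)⌋` puts the final angle within `θ` of `π / 2`, so the failure
probability is at most `sin θ ^ 2 = x ≤ ε`. If `x = 1`, no iteration is needed. -/
theorem exists_grover_iterations {x ε : ℝ} (hx₀ : 0 < x) (hx₁ : x ≤ 1) (hε : 0 < ε)
    (hx : x ≤ ε ∨ x = 1) :
    ∃ t : ℕ, (t : ℝ) ≤ (√x)⁻¹ ∧ 1 - ε ≤ Real.sin ((2 * t + 1) * Real.arcsin √x) ^ 2 := by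
  rcases hx with hx | rfl
  · set θ := Real.arcsin √x with hθ
    have hsx : 0 < √x := Real.sqrt_pos.2 hx₀
    have hsin : Real.sin θ = √x :=
      Real.sin_arcsin (by linarith) (Real.sqrt_le_one.2 hx₁)
    have hθ₀ : 0 < θ := Real.arcsin_pos.2 hsx
    have hθ₁ : θ ≤ Real.pi / 2 := Real.arcsin_le_pi_div_two _
    have hθx : √x ≤ θ := hsin ▸ Real.sin_le hθ₀.le
    have hπ := Real.pi_pos
    have ht₁ : (⌊Real.pi / (4 * θ)⌋₊ : ℝ) ≤ Real.pi / (4 * θ) := Nat.floor_le (by positivity)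
    have ht₂ : Real.pi / (4 * θ) < ⌊Real.pi / (4 * θ)⌋₊ + 1 := Nat.lt_floor_add_one _
    refine ⟨⌊Real.pi / (4 * θ)⌋₊, ht₁.trans ?_, ?_⟩
    · rw [div_le_iff₀ (by positivity), ← div_eq_inv_mul, le_div_iff₀ hsx]
      nlinarith [Real.pi_le_four]
    · rw [le_div_iff₀ (by positivity)] at ht₁
      rw [div_lt_iff₀ (by positivity)] at ht₂
      set φ := (2 * (⌊Real.pi / (4 * θ)⌋₊ : ℝ) + 1) * θ with hφ
      have h₁ : |φ - Real.pi / 2| ≤ θ := by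
        rw [abs_le]; constructor <;> linarith
      have h₂ : Real.cos θ ≤ Real.sin φ := by
        rw [← Real.cos_sub_pi_div_two, ← Real.cos_abs (φ - _)]
        exact Real.cos_le_cos_of_nonneg_of_le_pi (abs_nonneg _) (by linarith) h₁
      have h₃ : 0 ≤ Real.cos θ := Real.cos_nonneg_of_mem_Icc ⟨by linarith, hθ₁⟩
      have h₄ : Real.cos θ ^ 2 = 1 - x := by
        rw [Real.cos_sq', hsin, Real.sq_sqrt hx₀.le]
      have := pow_le_pow_left₀ h₃ h₂ 2
      linarith
  · exact ⟨0, by simp, by simp [hε.le]⟩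

theorem exists_solves {N M : ℕ} [NeZero M] (hN : 1 ≤ N) {ε : ℝ} (hε : 0 < ε) :
    ∃ A : PairAlgorithm N M, Solves A ε ∧
      (A.queries : ℝ) ≤ (5 + 8 / ε) * (N : ℝ) ^ (1 / 3 : ℝ) := by
  have hN₀ : (0 : ℝ) < N := by exact_mod_cast hN
  have hN₁ : (1 : ℝ) ≤ N := by exact_mod_cast hN
  set c : ℝ := (N : ℝ) ^ (1 / 3 : ℝ) with hc
  have hc₁ : 1 ≤ c := Real.one_le_rpow hN₁ (by norm_num)
  have hc₃ : c ^ 3 = N := by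
    rw [hc, ← Real.rpow_natCast, ← Real.rpow_mul hN₀.le]; norm_num
  have key : ∀ k t : ℕ, 0 < k → k ≤ N →
      1 - ε ≤ Real.sin ((2 * t + 1) * Real.arcsin √(k / N : ℝ)) ^ 2 →
      Solves (groverAlgorithm (M := M) hN k t) ε := by
    intro k t hk hkN h
    constructor
    · rintro ⟨f, g⟩ hp
      rw [groverAlgorithm_acceptProb_of_range_eq hN t f g hk hkN (mem_equalPairs.1 hp)]
      exact h
    · rintro ⟨f, g⟩ hp
      rw [groverAlgorithm_acceptProb_of_disjoint hN t f g hk (mem_disjointPairs.1 hp)]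
      exact hε.le
  have hq : ∀ k t : ℕ, ((groverAlgorithm (N := N) (M := M) hN k t).queries : ℝ) =
      k + (2 * t + 1) := fun k t => by
    change ((k + (2 * t + 1) : ℕ) : ℝ) = _
    push_cast; ring
  have hk₁ : c ≤ ⌈c⌉₊ := Nat.le_ceil c
  have hk₂ : (⌈c⌉₊ : ℝ) ≤ 2 * c := by
    have := Nat.ceil_lt_add_one (by linarith : 0 ≤ c)
    linarith
  have hkN : ⌈c⌉₊ ≤ N := by
    rw [Nat.ceil_le, ← hc₃]
    nlinarith [sq_nonneg c]
  have hk₀ : (0 : ℝ) < ⌈c⌉₊ := by linarith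
  -- If the marked fraction is at most `ε`, a list of length `⌈c⌉₊` works, with `t ≤ c`. Otherwise
  -- `N < 2 * c / ε`, and listing all of `f` is affordable and marks every point.
  rcases le_or_gt ((⌈c⌉₊ : ℝ) / N) ε with h | h
  · obtain ⟨t, ht₁, ht₂⟩ := exists_grover_iterations (x := (⌈c⌉₊ : ℝ) / N) (by positivity)
      (by rw [div_le_one hN₀]; exact_mod_cast hkN) hε (Or.inl h)
    refine ⟨_, key _ t (by exact_mod_cast hk₀) hkN ht₂, ?_⟩
    have ht : (t : ℝ) ≤ c := by
      refine ht₁.trans ?_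
      rw [inv_le_comm₀ (Real.sqrt_pos.2 (by positivity)) (by linarith)]
      refine Real.le_sqrt_of_sq_le ?_
      rw [le_div_iff₀ hN₀, ← hc₃]
      have : c⁻¹ ^ 2 * c ^ 3 = c := by field_simp
      rw [this]; exact hk₁
    rw [hq]
    have : 0 ≤ 8 / ε * c := by positivity
    linarith
  · obtain ⟨t, ht₁, ht₂⟩ := exists_grover_iterations (x := (N : ℝ) / N) (by positivity)
      (div_self hN₀.ne').le hε (Or.inr (div_self hN₀.ne'))
    refine ⟨_, key N t hN le_rfl ht₂, ?_⟩
    rw [div_self hN₀.ne'] at ht₁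
    rw [lt_div_iff₀ hN₀] at h
    have h₁ : (N : ℝ) ≤ 2 / ε * c := by
      rw [div_mul_eq_mul_div, le_div_iff₀ hε]; linarith
    have h₂ : (t : ℝ) ≤ 1 := by simpa using ht₁
    rw [hq]
    have e : (5 + 8 / ε) * c = 5 * c + 4 * (2 / ε * c) := by ring
    rw [e]
    linarith

end SetEquality

end

/-- Part one: the distinguishing advantage of `q` queries is `O(q ^ 3 / N)`. Part two: for each
fixed error below one half, `Θ(N ^ (1 / 3))` queries are necessary (already for random inputs)
and sufficient (even for worst-case inputs); all constants are independent of `M`. -/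
theorem mainTheorem3 :
    (∃ C : ℝ, 0 < C ∧ ∀ (N M : ℕ) [NeZero M], 1 ≤ N → 2 * N ≤ M →
      ∀ A : SetEquality.PairAlgorithm N M,
        SetEquality.advantage A ≤ C * (A.queries : ℝ) ^ 3 / (N : ℝ)) ∧
    (∀ ε : ℝ, 0 < ε → ε < 1 / 2 → ∃ c C : ℝ, 0 < c ∧ 0 < C ∧
      ∀ (N M : ℕ) [NeZero M], 1 ≤ N → 2 * N ≤ M →
        (∀ A : SetEquality.PairAlgorithm N M, SetEquality.Distinguishes A ε →
          c * (N : ℝ) ^ (1 / 3 : ℝ) ≤ (A.queries : ℝ)) ∧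
        (∃ A : SetEquality.PairAlgorithm N M, SetEquality.Solves A ε ∧
          SetEquality.Distinguishes A ε ∧
          (A.queries : ℝ) ≤ C * (N : ℝ) ^ (1 / 3 : ℝ))) := by
  refine ⟨⟨384, by norm_num, fun N M _ hN hM A => SetEquality.advantage_le hN hM A⟩, ?_⟩
  intro ε hε hε'
  refine ⟨((1 - 2 * ε) / 384) ^ (1 / 3 : ℝ), 5 + 8 / ε,
    Real.rpow_pos_of_pos (by linarith) _, by positivity, ?_⟩
  intro N M _ hN hM
  refine ⟨fun A hA => SetEquality.le_queries_of_distinguishes hN hM hε' hA, ?_⟩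
  obtain ⟨A, hA, hq⟩ := SetEquality.exists_solves (M := M) hN hε
  exact ⟨A, hA, hA.distinguishes hM, hq⟩
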